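/- Let $d\ge 1$ and let $D\subset\mathbb{R}^d$ be a bounded open set (in particular, $D$ may be a bounded Lipschitz domain in dimension $1$, $2$ or $3$). Let $x_1,\dots,x_m$ be the points of a regular rectangular grid (equidistant in each coordinate direction) whose closed bounding box contains $D$. Let $B\in\mathbb{R}^{m\times s}$ and $\overline Z\in\mathbb{R}^m$. For $y\in\mathbb{R}^s$ put $$a_s^y(x_i)=\exp\Big(\sum_{j=1}^s B_{ij}y_j+\overline Z_i\Big),\qquad i=1,\dots,m,$$ and extend $a_s^y$ to $D$ by multilinear interpolation between the grid points. (When $\Sigma=BB^\top$ is the covariance matrix and $\overline Z$ the mean vector, at the grid points, of a Gaussian field $Z$, then $a_s^y$ with $y$ a sample of $Y\sim\mathcal N(0,I_s)$ is the interpolated circulant embedding sample of the lognormal field $a=\exp(Z)$.) Let $b_j=\max_i|B_{ij}|$. For $\nu\in\mathbb{N}_0^s$ put $|\nu|=\sum_j\nu_j$ and $b^\nu=\prod_j b_j^{\nu_j}$, and let $\partial^\nu$ be the $\nu$-th partial derivative with respect to $y$. Let $\|v\|_{H_0^1(D)}=\|\nabla v\|_{L^2(D)}$, and let $\|\cdot\|_{H^{-1}(D)}$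 be the dual norm. Let $z,g\in L^2(D)$. Then there are constants $c_1,c_2>0$ with $\|f\|_{H^{-1}(D)}\le c_1\|f\|_{L^2(D)}$ for all $f\in L^2(D)$ and $\|v\|_{L^2(D)}\le c_2\|v\|_{H_0^1(D)}$ for all $v\in H_0^1(D)$. Moreover, for every $y\in\mathbb{R}^s$ there are a unique $u_s^y\in H_0^1(D)$ and a unique $q_s^y\in H_0^1(D)$ such that, for all $v\in H_0^1(D)$, $$\int_D a_s^y\nabla u_s^y\cdot\nabla v\,dx=\int_D z v\,dx,\qquad \int_D a_s^y\nabla q_s^y\cdot\nabla v\,dx=\int_D (u_s^y-g)\,v\,dx .$$ The maps $y\mapsto u_s^y$ and $y\mapsto q_s^y$ from $\mathbb{R}^s$ to $H^1_0(D)$ are infinitely differentiable. Finally, let $y\in\mathbb{R}^s$, and let $a(\cdot)=\exp(Z(\cdot))$ be any exact sample of the field that belongs to $y$, that is, $Z$ is continuous on $\overline D$ and $Z(x_i)=\sum_j B_{ij}y_j+\overline Z_i$ for all $i$. Let $a_{\min}^y>0$ be the minimum of $a$ over $\overline D\cup\{x_1,\dots,x_m\}$ (so the minimum over $\overline D$ if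 the grid points lie in $\overline D$). Then for every $\nu\in\mathbb{N}_0^s$, $$\|\partial^\nu u_s^y\|_{H_0^1(D)}\le |\nu|!\,\frac{b^\nu}{(\ln 2)^{|\nu|}}\,\frac{\|z\|_{H^{-1}(D)}}{a_{\min}^y},$$ and, for all constants $c_1,c_2>0$ of the two embeddings above, with $C_q^y=\max\big(1,\frac{c_1c_2}{a_{\min}^y}\big)$, $$\|\partial^\nu q_s^y\|_{H_0^1(D)}\le (|\nu|+1)!\,\frac{b^\nu}{(\ln 2)^{|\nu|}}\,\frac{C_q^y}{a_{\min}^y}\,\big(\|z\|_{H^{-1}(D)}+\|g\|_{H^{-1}(D)}\big).$$ -/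

import Mathlib

open MeasureTheory
open scoped ContDiff

noncomputable section

/-- Euclidean space `ℝ^d`. -/
abbrev Euc (d : ℕ) : Type := EuclideanSpace ℝ (Fin d)

/-! ### Sobolev spaces -/

/-- `L²(D)`. -/
abbrev L2 {d : ℕ} (D : Set (Euc d)) : Type := Lp ℝ 2 ((volume : Measure (Euc d)).restrict D)

/-- `L²(D; ℝ^d)`. -/
abbrev L2Vec {d : ℕ} (D : Set (Euc d)) : Type :=
  Lp (Euc d) 2 ((volume : Measure (Euc d)).restrict D)

/-- The pairs `(φ, ∇φ)` with `φ` a smooth function with compact support in `D`. -/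
def testPairs {d : ℕ} (D : Set (Euc d)) : Set (WithLp 2 (L2 D × L2Vec D)) :=
  {p | ∃ φ : Euc d → ℝ, ContDiff ℝ ∞ φ ∧ HasCompactSupport φ ∧ tsupport φ ⊆ D ∧
    (p.fst =ᵐ[volume.restrict D] φ) ∧
    (p.snd =ᵐ[volume.restrict D] fun x => gradient φ x)}

/-- `H¹₀(D)`, the closure of the smooth functions with compact support in `D` with respect to
the `H¹`-norm `(‖v‖²_{L²} + ‖∇v‖²_{L²})^{1/2}`. An element is a pair `(v, ∇v)` that consists of
a function and its weak gradient. (`testPairs D` is already a linear subspace, so the span adds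
nothing.) -/
def h10Submodule {d : ℕ} (D : Set (Euc d)) : Submodule ℝ (WithLp 2 (L2 D × L2Vec D)) :=
  (Submodule.span ℝ (testPairs D)).topologicalClosure

/-- `H¹₀(D)` as a type. Its topology is that of the `H¹`-norm, which on a bounded open set is
equivalent to the norm `h10Norm` used in the estimates. -/
abbrev H10 {d : ℕ} (D : Set (Euc d)) : Type := ↥(h10Submodule D)

/-- The function underlying an element of `H¹₀(D)`. -/
def H10.fn {d : ℕ} {D : Set (Euc d)} (v : H10 D) : L2 D := v.1.fst

/-- The weak gradient of an element of `H¹₀(D)`. -/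
def H10.grad {d : ℕ} {D : Set (Euc d)} (v : H10 D) : L2Vec D := v.1.snd

/-- `‖v‖_{H¹₀(D)} = ‖∇v‖_{L²(D)}`. -/
def h10Norm {d : ℕ} {D : Set (Euc d)} (v : H10 D) : ℝ := ‖v.grad‖

/-- `‖f‖_{H⁻¹(D)}`, the norm of `f ∈ L²(D)` as a functional `v ↦ ∫_D f v` on `H¹₀(D)`:
the supremum of `|∫_D f v|` over the unit ball for `‖·‖_{H¹₀(D)}`. -/
def hMinusOneNorm {d : ℕ} {D : Set (Euc d)} (f : L2 D) : ℝ :=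
  ⨆ v : {v : H10 D // h10Norm v ≤ 1}, |∫ x in D, f x * v.1.fn x|

/-- `c` is a constant of the embedding `L²(D) ⊂ H⁻¹(D)`. -/
def IsEmbConstDual {d : ℕ} (D : Set (Euc d)) (c : ℝ) : Prop :=
  0 < c ∧ ∀ f : L2 D, hMinusOneNorm f ≤ c * ‖f‖

/-- `c` is a constant of the embedding `H¹₀(D) ⊂ L²(D)`. -/
def IsEmbConst {d : ℕ} (D : Set (Euc d)) (c : ℝ) : Prop :=
  0 < c ∧ ∀ v : H10 D, ‖v.fn‖ ≤ c * h10Norm v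

/-- `w ∈ H¹₀(D)` solves `-div (a ∇w) = f` weakly:
`∫_D a ∇w · ∇v = ∫_D f v` for all `v ∈ H¹₀(D)`. -/
def IsWeakSolution {d : ℕ} {D : Set (Euc d)} (a : Euc d → ℝ) (f : L2 D) (w : H10 D) : Prop :=
  ∀ v : H10 D, ∫ x in D, a x * inner ℝ (w.grad x) (v.grad x) = ∫ x in D, f x * v.fn x

/-! ### The interpolated lognormal field -/

/-- A regular rectangular grid in `ℝ^d`: in direction `k` it has the `n k + 1` equidistant
coordinates `origin k + i * spacing k`, `0 ≤ i ≤ n k`. -/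
structure RectGrid (d : ℕ) where
  origin : Fin d → ℝ
  spacing : Fin d → ℝ
  spacing_pos : ∀ k, 0 < spacing k
  n : Fin d → ℕ

/-- The (multi-)indices of the grid points. -/
abbrev RectGrid.Index {d : ℕ} (G : RectGrid d) : Type := (k : Fin d) → Fin (G.n k + 1)

/-- The grid points `x_i`. -/
def RectGrid.node {d : ℕ} (G : RectGrid d) (i : G.Index) : Euc d :=
  WithLp.toLp 2 fun k => G.origin k + ((i k : ℕ) : ℝ) * G.spacing k

/-- The closed box spanned by the grid. -/
def RectGrid.box {d : ℕ} (G : RectGrid d) : Set (Euc d) :=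
  {x | ∀ k, G.origin k ≤ x k ∧ x k ≤ G.origin k + (G.n k : ℝ) * G.spacing k}

/-- The interpolation weight of the grid point `x_i` at `x`, a product of one-dimensional hat
functions. For `x` in the box, the weights are nonnegative, add up to one, and vanish unless
`x_i` is one of the `2^d` vertices of a grid cell that contains `x`. -/
def RectGrid.weight {d : ℕ} (G : RectGrid d) (i : G.Index) (x : Euc d) : ℝ :=
  ∏ k, max 0 (1 - |x k - G.node i k| / G.spacing k)

/-- Multilinear interpolation of values at the grid points. -/
def RectGrid.interp {d : ℕ} (G : RectGrid d) (f : G.Index → ℝ) (x : Euc d) : ℝ :=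
  ∑ i, G.weight i x * f i

/-- The Gaussian field at the grid points, `∑_j B_{i,j} y_j + Z̄_i`. -/
def gaussNode {d s : ℕ} {G : RectGrid d} (B : Matrix G.Index (Fin s) ℝ) (Zbar : G.Index → ℝ)
    (y : Fin s → ℝ) (i : G.Index) : ℝ :=
  (∑ j, B i j * y j) + Zbar i

/-- The interpolated lognormal field `a_s^y(x)`. -/
def fieldCE {d s : ℕ} {G : RectGrid d} (B : Matrix G.Index (Fin s) ℝ) (Zbar : G.Index → ℝ)
    (y : Fin s → ℝ) : Euc d → ℝ :=
  G.interp fun i => Real.exp (gaussNode B Zbar y i)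

/-- `b_j = max_i |B_{i,j}|`. -/
def colMax {ι : Type} {s : ℕ} (B : Matrix ι (Fin s) ℝ) (j : Fin s) : ℝ := ⨆ i, |B i j|

/-- `a_min`, the minimum of the exact sample `a = exp Z` of the lognormal field over the closure
of `D` and the grid points. It is the minimum over the closure of `D` alone when, as is usual,
the grid points belong to that closure. -/
def aMin {d : ℕ} (D : Set (Euc d)) (G : RectGrid d) (Z : Euc d → ℝ) : ℝ :=
  sInf ((fun x => Real.exp (Z x)) '' (closure D ∪ Set.range G.node))

/-! ### Derivatives with respect to the parameters -/

/-- The partial derivative with respect to `y_j`. -/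
def partialD {s : ℕ} {V : Type} [NormedAddCommGroup V] [NormedSpace ℝ V] (j : Fin s)
    (F : (Fin s → ℝ) → V) : (Fin s → ℝ) → V :=
  fun y => fderiv ℝ F y (Pi.single j 1)

/-- `∂^ν F = ∂_1^{ν_1} ⋯ ∂_s^{ν_s} F` for a multi-index `ν`. -/
def multiD {s : ℕ} {V : Type} [NormedAddCommGroup V] [NormedSpace ℝ V] (ν : Fin s → ℕ)
    (F : (Fin s → ℝ) → V) : (Fin s → ℝ) → V :=
  (List.finRange s).foldr (fun j H => (partialD j)^[ν j] H) F

/-- `C_q = max (1, c₁ c₂ / a_min)`. -/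
def constQ (c₁ c₂ amin : ℝ) : ℝ := max 1 (c₁ * c₂ / amin)

end

/-!
The derivatives are estimated at one parameter `y₀` at a time, in the energy norm `‖J v‖` with
`J v = a(y₀)^{1/2} ∇v` (`energyMap`). On the grid, `a(y)` is a combination of hat functions with
coefficients `exp(θ_i(y))`, `θ_i` affine in `y`. With `ρ_i ≥ 0` the share of the `i`-th grid
point in `a(y₀)`, so that `∑ ρ_i = 1` on `D`, the operator of the problem is (`diffusionOp`,
`diffusionOp_eq_energyMap`)

  `T(y) = J† S(y) J`, with `S(y)` multiplication by `∑_i exp(θ_i(y) - θ_i(y₀)) ρ_i`.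

A solution of `T(y) u(y) = f(y)` therefore satisfies
`J u(y) = J T(y₀)⁻¹ f(y) - P (S(y) - 1) J u(y)`, where `P = J T(y₀)⁻¹ J†` is an orthogonal
projection. All derivatives of `S` at `y₀` have norm at most one if the parameters carry the
`ℓ¹`-norm weighted by (strict majorants of) `b_j`, and `S(y₀) = 1`. Hence the Leibniz rule bounds
`x_n = ‖Dⁿ(J u)(y₀)‖` by `∑_{k<n} (n choose k) x_k` plus the contribution of `f`
(`norm_iteratedFDeriv_solution_le`). As `∑_{j≥1} (ln 2)^j / j! = 1`, this recursion has the
majorant `n! / (ln 2)ⁿ` (`le_factorial_div_log_two_pow`). For `q` the right-hand side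
depends on `y` through `u`, which costs one more factor `n + 1`. The energy norm is compared with
`‖∇v‖` by `a(y₀) ≥ a_min`, which holds since interpolation weights are nonnegative and add up to
one, at the two ends of the estimate, which gives the factor `1 / a_min`.

A mixed partial derivative is an iterated Fréchet derivative in coordinate directions
(`exists_multiD_eq_iteratedFDeriv`, `norm_comp_multiD_le`). Existence, uniqueness and smoothness
follow from the Lax–Milgram theorem, the smoothness of operator inversion, and the Poincaré
inequality (`exists_isEmbConst`), which is obtained for test functions by integrating `φ² ∂ₖ xₖ`
by parts.
-/

/-! ### The recursion behind the factorial bounds -/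

theorem sum_log_two_pow_div_factorial_le_one (n : ℕ) :
    ∑ k ∈ Finset.range n, Real.log 2 ^ (n - k) / ((n - k).factorial : ℝ) ≤ 1 := by
  have h := Real.sum_le_exp_of_nonneg (Real.log_nonneg (by norm_num : (1 : ℝ) ≤ 2)) (n + 1)
  rw [Real.exp_log (by norm_num), Finset.sum_range_succ'] at h
  have h' := Finset.sum_range_reflect
    (fun k => Real.log 2 ^ (k + 1) / ((k + 1).factorial : ℝ)) n
  have e : ∑ k ∈ Finset.range n, Real.log 2 ^ (n - k) / ((n - k).factorial : ℝ) =
      ∑ k ∈ Finset.range n, Real.log 2 ^ (n - 1 - k + 1) / ((n - 1 - k + 1).factorial : ℝ) := by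
    refine Finset.sum_congr rfl fun k hk => ?_
    have : n - k = n - 1 - k + 1 := by have := Finset.mem_range.1 hk; omega
    rw [this]
  rw [e, h']
  simp at h
  linarith

/-- A discrete Gronwall inequality for binomial convolutions: the homogeneous recursion is
dominated by `n! / (ln 2)ⁿ`, because `∑_{j ≥ 1} (ln 2)ʲ / j! = 1`, and `w` absorbs the
inhomogeneity. -/
theorem le_factorial_div_log_two_pow {x w : ℕ → ℝ} (hw : Monotone w) (hw0 : 0 ≤ w 0)
    (h0 : x 0 ≤ w 0)
    (h : ∀ n, x (n + 1) ≤ ∑ k ∈ Finset.range (n + 1), ((n + 1).choose k : ℝ) * x k +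
      (n + 1).factorial / Real.log 2 ^ (n + 1) * (w (n + 1) - w n)) (n : ℕ) :
    x n ≤ n.factorial / Real.log 2 ^ n * w n := by
  have hl : 0 < Real.log 2 := Real.log_pos (by norm_num)
  induction n using Nat.strong_induction_on with
  | _ n ih =>
    cases n with
    | zero => simpa using h0
    | succ n =>
      have hwn : 0 ≤ w n := hw0.trans (hw (Nat.zero_le n))
      have key : ∑ k ∈ Finset.range (n + 1), ((n + 1).choose k : ℝ) * x k ≤
          (n + 1).factorial / Real.log 2 ^ (n + 1) * w n := by
        calc ∑ k ∈ Finset.range (n + 1), ((n + 1).choose k : ℝ) * x k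
            ≤ ∑ k ∈ Finset.range (n + 1), (n + 1).factorial / Real.log 2 ^ (n + 1) * w n *
                (Real.log 2 ^ (n + 1 - k) / ((n + 1 - k).factorial : ℝ)) := by
              refine Finset.sum_le_sum fun k hk => ?_
              have hk' : k < n + 1 := Finset.mem_range.1 hk
              have hwk : w k ≤ w n := hw (Nat.lt_succ_iff.1 hk')
              have hpow : Real.log 2 ^ (n + 1) = Real.log 2 ^ (n + 1 - k) * Real.log 2 ^ k := by
                rw [← pow_add]; congr 1; omega
              calc ((n + 1).choose k : ℝ) * x k
                  ≤ ((n + 1).choose k : ℝ) * (k.factorial / Real.log 2 ^ k * w n) := by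
                    gcongr
                    exact (ih k hk').trans (by gcongr)
                _ = _ := by
                    rw [Nat.cast_choose ℝ hk'.le, hpow]
                    have := Nat.factorial_ne_zero k
                    have := Nat.factorial_ne_zero (n + 1 - k)
                    field_simp
          _ = (n + 1).factorial / Real.log 2 ^ (n + 1) * w n *
                ∑ k ∈ Finset.range (n + 1),
                  (Real.log 2 ^ (n + 1 - k) / ((n + 1 - k).factorial : ℝ)) := by
              rw [Finset.mul_sum]
          _ ≤ (n + 1).factorial / Real.log 2 ^ (n + 1) * w n * 1 := by
              gcongr
              exact sum_log_two_pow_div_factorial_le_one (n + 1)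
          _ = _ := mul_one _
      calc x (n + 1) ≤ _ := h n
        _ ≤ (n + 1).factorial / Real.log 2 ^ (n + 1) * w n +
            (n + 1).factorial / Real.log 2 ^ (n + 1) * (w (n + 1) - w n) := by gcongr
        _ = _ := by ring

/-! ### Iterated derivatives -/

theorem fderiv_iteratedFDeriv_apply {E F : Type*} [NormedAddCommGroup E] [NormedSpace ℝ E]
    [NormedAddCommGroup F] [NormedSpace ℝ F] {f : E → F} (hf : ContDiff ℝ ∞ f) (n : ℕ)
    (m : Fin n → E) (x h : E) :
    fderiv ℝ (fun y => iteratedFDeriv ℝ n f y m) x h =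
      iteratedFDeriv ℝ (n + 1) f x (Fin.cons h m) := by
  rw [iteratedFDeriv_succ_apply_left, fderiv_continuousMultilinear_apply_const_apply]
  · simp
  · exact (hf.differentiable_iteratedFDeriv (by exact_mod_cast ENat.natCast_lt_top n)) x

theorem iteratedFDeriv_sum_exp_smul {E F ι : Type*} [NormedAddCommGroup E] [NormedSpace ℝ E]
    [NormedAddCommGroup F] [NormedSpace ℝ F] [Fintype ι] (l : ι → E →L[ℝ] ℝ) (a : ι → ℝ)
    (M : ι → F) (n : ℕ) (m : Fin n → E) (x : E) :
    iteratedFDeriv ℝ n (fun y => ∑ i, Real.exp (l i y + a i) • M i) x m =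
      ∑ i, (Real.exp (l i x + a i) * ∏ k, l i (m k)) • M i := by
  have hs : ContDiff ℝ ∞ (fun y => ∑ i, Real.exp (l i y + a i) • M i) := by fun_prop
  induction n generalizing x with
  | zero => simp
  | succ n ih =>
    rw [← Fin.cons_self_tail m, ← fderiv_iteratedFDeriv_apply hs n (Fin.tail m) x (m 0)]
    simp_rw [ih]
    rw [fderiv_fun_sum (fun i _ => by fun_prop)]
    rw [sum_apply]
    refine Finset.sum_congr rfl fun i _ => ?_
    have h1 : HasFDerivAt (fun y => Real.exp (l i y + a i)) (Real.exp (l i x + a i) • l i) x :=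
      (((l i).hasFDerivAt).add_const (a i)).exp
    have h2 := ((h1.mul_const (∏ k, l i (Fin.tail m k))).smul_const (M i)).fderiv
    rw [h2, Fin.prod_univ_succ]
    simp
    congr 1
    ring

/-- The Leibniz rule in the form that isolates the top-order term: since `N x₀ = 0`, the
derivative of order `n` of `U` drops out of the right-hand side. -/
theorem norm_iteratedFDeriv_le_of_eq_sub {E H : Type*} [NormedAddCommGroup E] [NormedSpace ℝ E]
    [NormedAddCommGroup H] [NormedSpace ℝ H] {U F : E → H} {N : E → H →L[ℝ] H} {P : H →L[ℝ] H}
    (hU : ContDiff ℝ ∞ U) (hF : ContDiff ℝ ∞ F) (hN : ContDiff ℝ ∞ N) (hP : ‖P‖ ≤ 1)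
    (hUF : ∀ x, U x = F x - P (N x (U x))) {x₀ : E} (hN0 : N x₀ = 0)
    (hNk : ∀ k, 0 < k → ‖iteratedFDeriv ℝ k N x₀‖ ≤ 1) (n : ℕ) :
    ‖iteratedFDeriv ℝ n U x₀‖ ≤
      ∑ k ∈ Finset.range n, (n.choose k : ℝ) * ‖iteratedFDeriv ℝ k U x₀‖ +
      ‖iteratedFDeriv ℝ n F x₀‖ := by
  have hn : ((n : ℕ∞) : WithTop ℕ∞) ≤ ∞ := by exact_mod_cast le_top
  have hNU : ContDiff ℝ ∞ fun x => N x (U x) := hN.clm_apply hU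
  have e : U = F - P ∘ fun x => N x (U x) := funext hUF
  have h1 : ‖iteratedFDeriv ℝ n (fun x => N x (U x)) x₀‖ ≤
      ∑ k ∈ Finset.range n, (n.choose k : ℝ) * ‖iteratedFDeriv ℝ k U x₀‖ := by
    refine (norm_iteratedFDeriv_clm_apply hN hU x₀ (n := n) hn).trans ?_
    -- The term of order zero in `N` is the one with the top-order derivative of `U`.
    rw [Finset.sum_range_succ', Nat.choose_zero_right]
    simp only [norm_iteratedFDeriv_zero, hN0, norm_zero, mul_zero, zero_mul, add_zero]
    rw [← Finset.sum_range_reflect (fun k => (n.choose k : ℝ) * ‖iteratedFDeriv ℝ k U x₀‖)]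
    refine Finset.sum_le_sum fun k hk => ?_
    have hk' := Finset.mem_range.1 hk
    have e1 : n - 1 - k = n - (k + 1) := by omega
    rw [e1, Nat.choose_symm (by omega : k + 1 ≤ n)]
    gcongr
    exact mul_le_of_le_one_right (by positivity) (hNk (k + 1) k.succ_pos)
  conv_lhs => rw [e]
  rw [iteratedFDeriv_sub_apply (hF.of_le hn).contDiffAt
    ((P.contDiff.comp hNU).of_le hn).contDiffAt]
  refine (norm_sub_le _ _).trans ?_
  rw [add_comm]
  gcongr
  refine (P.norm_iteratedFDeriv_comp_left hNU.contDiffAt hn).trans ?_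
  exact (mul_le_of_le_one_left (norm_nonneg _) hP).trans h1

/-! ### Coercive operators -/

theorem apply_eq_iff_eq_ringInverse {V : Type*} [NormedAddCommGroup V] [NormedSpace ℝ V]
    {T : V →L[ℝ] V} (hT : IsUnit T) (v f : V) :
    T v = f ↔ v = Ring.inverse T f := by
  constructor
  · rintro rfl
    exact (DFunLike.congr_fun (Ring.inverse_mul_cancel T hT) v).symm
  · rintro rfl
    exact DFunLike.congr_fun (Ring.mul_inverse_cancel T hT) f

section Coercive

variable {V H : Type*} [NormedAddCommGroup V] [InnerProductSpace ℝ V] [CompleteSpace V]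
  [NormedAddCommGroup H] [InnerProductSpace ℝ H] [CompleteSpace H]

open ContinuousLinearMap

/-- The Lax–Milgram theorem for operators. -/
theorem isUnit_of_coercive {T : V →L[ℝ] V} {c : ℝ} (hc : 0 < c)
    (hT : ∀ v, c * ‖v‖ * ‖v‖ ≤ inner ℝ (T v) v) : IsUnit T := by
  have hB : IsCoercive (innerSL ℝ ∘L T) := ⟨c, hc, fun v => by
    rw [ContinuousLinearMap.comp_apply, innerSL_apply_apply]; exact hT v⟩
  have e : (hB.continuousLinearEquivOfBilin : V →L[ℝ] V) = T := by
    ext v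
    refine ext_inner_right ℝ fun w => ?_
    exact hB.continuousLinearEquivOfBilin_apply v w
  rw [← e]
  exact (ContinuousLinearEquiv.toUnit hB.continuousLinearEquivOfBilin).isUnit

theorem contDiff_ringInverse_apply {E : Type*} [NormedAddCommGroup E] [NormedSpace ℝ E]
    {T : E → V →L[ℝ] V} (hT : ContDiff ℝ ∞ T) (hu : ∀ x, IsUnit (T x)) {f : E → V}
    (hf : ContDiff ℝ ∞ f) : ContDiff ℝ ∞ fun x => Ring.inverse (T x) (f x) := by
  refine ContDiff.clm_apply ?_ hf
  refine contDiff_iff_contDiffAt.2 fun x => ?_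
  have h := contDiffAt_ringInverse ℝ (n := ∞) (hu x).unit
  rw [IsUnit.unit_spec] at h
  exact h.comp x hT.contDiffAt

variable (J : V →L[ℝ] H)

theorem inner_adjoint_comp_self (v w : V) :
    inner ℝ ((adjoint J ∘L J) v) w = inner ℝ (J v) (J w) := by
  simp [adjoint_inner_left]

/-- `J (J†J)⁻¹ J†`, the orthogonal projection onto the range of `J`, is a contraction. -/
theorem norm_rangeProj_le_one (hJ : IsUnit (adjoint J ∘L J)) :
    ‖J ∘L Ring.inverse (adjoint J ∘L J) ∘L adjoint J‖ ≤ 1 := by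
  refine opNorm_le_bound _ zero_le_one fun w => ?_
  rw [one_mul]
  set v := Ring.inverse (adjoint J ∘L J) (adjoint J w) with hv
  have h1 : (adjoint J ∘L J) v = adjoint J w := (apply_eq_iff_eq_ringInverse hJ _ _).2 hv
  have h2 : ‖J v‖ * ‖J v‖ ≤ ‖w‖ * ‖J v‖ := by
    rw [← real_inner_self_eq_norm_mul_norm, ← inner_adjoint_comp_self, h1, adjoint_inner_left]
    exact real_inner_le_norm _ _
  change ‖J v‖ ≤ ‖w‖
  rcases (norm_nonneg (J v)).eq_or_lt with h | h
  · rw [← h]; exact norm_nonneg w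
  · exact le_of_mul_le_mul_right h2 h

/-! ### Solutions of equations with a log-linear coefficient -/

variable {E ι : Type*} [NormedAddCommGroup E] [NormedSpace ℝ E] [Fintype ι]
  {l : ι → E →L[ℝ] ℝ} {M : ι → H →L[ℝ] H} {x₀ : E} {T : E → V →L[ℝ] V}

/-- In the energy norm `‖J ·‖` at the parameter `x₀`, the derivatives of the solution `u` of
`T u = f` satisfy the binomial recursion. -/
theorem norm_iteratedFDeriv_solution_le (hl : ∀ i, ‖l i‖ ≤ 1)
    (hM : ∀ (t : ι → ℝ) (c : ℝ), 0 ≤ c → (∀ i, |t i| ≤ c) → ‖∑ i, t i • M i‖ ≤ c)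
    (hM1 : ∑ i, M i = 1) (hT : ∀ x, IsUnit (T x))
    (hTJ : ∀ x, T x = adjoint J ∘L (∑ i, Real.exp (l i (x - x₀)) • M i) ∘L J)
    {u f : E → V} (hu : ContDiff ℝ ∞ u) (hf : ContDiff ℝ ∞ f) (huf : ∀ x, T x (u x) = f x)
    (n : ℕ) :
    ‖iteratedFDeriv ℝ n (J ∘ u) x₀‖ ≤
      ∑ k ∈ Finset.range n, (n.choose k : ℝ) * ‖iteratedFDeriv ℝ k (J ∘ u) x₀‖ +
      ‖iteratedFDeriv ℝ n ((J ∘L Ring.inverse (T x₀)) ∘ f) x₀‖ := by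
  have hT0 : T x₀ = adjoint J ∘L J := by
    rw [hTJ]
    simp only [sub_self, map_zero, Real.exp_zero, one_smul, hM1]
    rfl
  have hJ : IsUnit (adjoint J ∘L J) := hT0 ▸ hT x₀
  have hexp : ∀ x i, Real.exp (l i (x - x₀)) = Real.exp (l i x + -(l i x₀)) := fun x i => by
    rw [map_sub, sub_eq_add_neg]
  have hSs : ContDiff ℝ ∞ fun x => ∑ i, Real.exp (l i x + -(l i x₀)) • M i := by fun_prop
  refine norm_iteratedFDeriv_le_of_eq_sub (N := fun x => (∑ i, Real.exp (l i x + -(l i x₀)) • M i)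
    - 1) (P := J ∘L Ring.inverse (adjoint J ∘L J) ∘L adjoint J) (J.contDiff.comp hu)
    ((ContinuousLinearMap.contDiff _).comp hf) (hSs.sub contDiff_const)
    (norm_rangeProj_le_one J hJ) ?_ ?_ ?_ n
  · intro x
    have h := huf x
    rw [hTJ x] at h
    simp only [hexp] at h
    rw [hT0]
    set S := ∑ i, Real.exp (l i x + -(l i x₀)) • M i
    have h3 : (adjoint J ∘L J) (u x) = f x - adjoint J ((S - 1) (J (u x))) := by
      rw [← h]; simp
    rw [apply_eq_iff_eq_ringInverse hJ, map_sub] at h3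
    have h4 := congrArg J h3
    rw [map_sub] at h4
    exact h4
  · simp [hM1]
  · intro k hk
    have hk' : ((k : ℕ∞) : WithTop ℕ∞) ≤ ∞ := by exact_mod_cast le_top
    have e : iteratedFDeriv ℝ k (fun x => (∑ i, Real.exp (l i x + -(l i x₀)) • M i) - 1) x₀ =
        iteratedFDeriv ℝ k (fun x => ∑ i, Real.exp (l i x + -(l i x₀)) • M i) x₀ := by
      rw [fun_iteratedFDeriv_sub_apply (hSs.of_le hk').contDiffAt contDiffAt_const,
        iteratedFDeriv_const_of_ne hk.ne']
      simp
    rw [e]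
    refine ContinuousMultilinearMap.opNorm_le_bound zero_le_one fun m => ?_
    rw [iteratedFDeriv_sum_exp_smul, one_mul]
    refine hM _ _ (by positivity) fun i => ?_
    rw [add_neg_cancel, Real.exp_zero, one_mul, Finset.abs_prod]
    refine Finset.prod_le_prod (fun _ _ => abs_nonneg _) fun j _ => ?_
    calc |l i (m j)| ≤ ‖l i‖ * ‖m j‖ := (l i).le_opNorm _
      _ ≤ ‖m j‖ := mul_le_of_le_one_left (norm_nonneg _) (hl i)

/-- For a constant right-hand side the recursion is homogeneous for orders `n ≥ 1`. -/
theorem norm_iteratedFDeriv_solution_le_factorial (hl : ∀ i, ‖l i‖ ≤ 1)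
    (hM : ∀ (t : ι → ℝ) (c : ℝ), 0 ≤ c → (∀ i, |t i| ≤ c) → ‖∑ i, t i • M i‖ ≤ c)
    (hM1 : ∑ i, M i = 1) (hT : ∀ x, IsUnit (T x))
    (hTJ : ∀ x, T x = adjoint J ∘L (∑ i, Real.exp (l i (x - x₀)) • M i) ∘L J)
    {u : E → V} (hu : ContDiff ℝ ∞ u) {f : V} (huf : ∀ x, T x (u x) = f) (n : ℕ) :
    ‖iteratedFDeriv ℝ n (J ∘ u) x₀‖ ≤ n.factorial / Real.log 2 ^ n * ‖J (u x₀)‖ := by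
  refine le_factorial_div_log_two_pow (x := fun n => ‖iteratedFDeriv ℝ n (J ∘ u) x₀‖)
    (w := fun _ => ‖J (u x₀)‖) monotone_const (norm_nonneg _) (by simp) (fun n => ?_) n
  have h := norm_iteratedFDeriv_solution_le J hl hM hM1 hT hTJ hu (f := fun _ => f)
    contDiff_const huf (n + 1)
  have e : ((J ∘L Ring.inverse (T x₀)) ∘ fun _ : E => f) =
    fun _ => (J ∘L Ring.inverse (T x₀)) f := rfl
  rw [e, iteratedFDeriv_succ_const] at h
  simpa using h

/-- The bound for a solution `q` whose right-hand side depends on the parameter through a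
solution `u` with constant right-hand side. -/
theorem norm_iteratedFDeriv_coupled_solution_le_factorial (hl : ∀ i, ‖l i‖ ≤ 1)
    (hM : ∀ (t : ι → ℝ) (c : ℝ), 0 ≤ c → (∀ i, |t i| ≤ c) → ‖∑ i, t i • M i‖ ≤ c)
    (hM1 : ∑ i, M i = 1) (hT : ∀ x, IsUnit (T x))
    (hTJ : ∀ x, T x = adjoint J ∘L (∑ i, Real.exp (l i (x - x₀)) • M i) ∘L J)
    {u q : E → V} (hu : ContDiff ℝ ∞ u) (hq : ContDiff ℝ ∞ q) {f g : V} {b : V →L[ℝ] V}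
    (huf : ∀ x, T x (u x) = f) (hqf : ∀ x, T x (q x) = b (u x) - g) {κ K : ℝ} (hκ : 0 ≤ κ)
    (hb : ∀ v, ‖J (Ring.inverse (T x₀) (b v))‖ ≤ κ * ‖J v‖) (hK1 : ‖J (q x₀)‖ ≤ K)
    (hK2 : κ * ‖J (u x₀)‖ ≤ K) (n : ℕ) :
    ‖iteratedFDeriv ℝ n (J ∘ q) x₀‖ ≤ (n + 1).factorial / Real.log 2 ^ n * K := by
  have hl2 : 0 < Real.log 2 := Real.log_pos (by norm_num)
  have hK0 : 0 ≤ K := (norm_nonneg _).trans hK1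
  have main := le_factorial_div_log_two_pow (x := fun n => ‖iteratedFDeriv ℝ n (J ∘ q) x₀‖)
    (w := fun n => (n + 1) * K) (fun a b hab => by dsimp only; gcongr) (by simpa using hK0)
    (by simpa using hK1) (fun n => ?_) n
  · refine main.trans_eq ?_
    rw [Nat.factorial_succ]
    push_cast
    ring
  have hn : (((n + 1 : ℕ) : ℕ∞) : WithTop ℕ∞) ≤ ∞ := by exact_mod_cast le_top
  refine (norm_iteratedFDeriv_solution_le J hl hM hM1 hT hTJ hq (f := fun x => b (u x) - g)
    ((b.contDiff.comp hu).sub contDiff_const) hqf (n + 1)).trans ?_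
  gcongr
  have e : iteratedFDeriv ℝ (n + 1)
      ((J ∘L Ring.inverse (T x₀)) ∘ fun x => b (u x) - g) x₀ =
      iteratedFDeriv ℝ (n + 1) ((J ∘L Ring.inverse (T x₀) ∘L b) ∘ u) x₀ := by
    have e1 : ((J ∘L Ring.inverse (T x₀)) ∘ fun x => b (u x) - g) =
        ((J ∘L Ring.inverse (T x₀) ∘L b) ∘ u) - fun _ => (J ∘L Ring.inverse (T x₀)) g := by
      ext x; simp
    rw [e1, iteratedFDeriv_sub_apply
      (((ContinuousLinearMap.contDiff _).comp hu).of_le hn).contDiffAt contDiffAt_const,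
      iteratedFDeriv_succ_const]
    simp
  rw [e]
  have hbound : ‖iteratedFDeriv ℝ (n + 1) ((J ∘L Ring.inverse (T x₀) ∘L b) ∘ u) x₀‖ ≤
      κ * ‖iteratedFDeriv ℝ (n + 1) (J ∘ u) x₀‖ := by
    refine ContinuousMultilinearMap.opNorm_le_bound (by positivity) fun m => ?_
    rw [ContinuousLinearMap.iteratedFDeriv_comp_left _ hu.contDiffAt hn]
    refine (hb _).trans ?_
    rw [mul_assoc]
    gcongr
    refine le_trans (le_of_eq ?_) (ContinuousMultilinearMap.le_opNorm _ _)
    rw [ContinuousLinearMap.iteratedFDeriv_comp_left _ hu.contDiffAt hn]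
    rfl
  calc _ ≤ _ := hbound
    _ ≤ κ * ((n + 1).factorial / Real.log 2 ^ (n + 1) * ‖J (u x₀)‖) := by
        gcongr
        exact norm_iteratedFDeriv_solution_le_factorial J hl hM hM1 hT hTJ hu huf (n + 1)
    _ = (n + 1).factorial / Real.log 2 ^ (n + 1) * (κ * ‖J (u x₀)‖) := by ring
    _ ≤ (n + 1).factorial / Real.log 2 ^ (n + 1) * (((n + 1 : ℕ) + 1) * K - (n + 1) * K) := by
        gcongr
        push_cast
        linarith

end Coercive

/-! ### Mixed partial derivatives -/

section PartialDerivatives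

variable {s : ℕ} {V : Type} [NormedAddCommGroup V] [NormedSpace ℝ V]

theorem partialD_iteratedFDeriv_apply {F : (Fin s → ℝ) → V} (hF : ContDiff ℝ ∞ F) {n : ℕ}
    (k : Fin n → Fin s) (j : Fin s) :
    partialD j (fun y => iteratedFDeriv ℝ n F y fun i => Pi.single (k i) 1) =
      fun y => iteratedFDeriv ℝ (n + 1) F y
        fun i => Pi.single ((Fin.cons j k : _ → Fin s) i) 1 := by
  funext y
  rw [partialD, fderiv_iteratedFDeriv_apply hF]
  congr 1
  funext i
  refine Fin.cases ?_ (fun i => ?_) i <;> simp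

/-- A mixed partial derivative is an iterated Fréchet derivative in coordinate directions `k`,
where `∏ i, c (k i) = ∏ j, c j ^ ν j` expresses that each direction `j` occurs `ν j` times. -/
theorem exists_multiD_eq_iteratedFDeriv {F : (Fin s → ℝ) → V} (hF : ContDiff ℝ ∞ F)
    (ν : Fin s → ℕ) :
    ∃ k : Fin (∑ j, ν j) → Fin s,
      (∀ y, multiD ν F y = iteratedFDeriv ℝ (∑ j, ν j) F y fun i => Pi.single (k i) 1) ∧
      ∀ c : Fin s → ℝ, ∏ i, c (k i) = ∏ j, c j ^ ν j := by
  have iter : ∀ (j : Fin s) (r n : ℕ) (k : Fin n → Fin s), ∃ k' : Fin (r + n) → Fin s,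
      ((partialD j)^[r] fun y => iteratedFDeriv ℝ n F y fun i => Pi.single (k i) 1) =
        (fun y => iteratedFDeriv ℝ (r + n) F y fun i => Pi.single (k' i) 1) ∧
      ∀ c : Fin s → ℝ, ∏ i, c (k' i) = c j ^ r * ∏ i, c (k i) := by
    intro j r n k
    induction r with
    | zero =>
      rw [Nat.zero_add]
      exact ⟨k, rfl, by simp⟩
    | succ r ih =>
      obtain ⟨k', h1, h2⟩ := ih
      rw [Nat.add_right_comm]
      refine ⟨Fin.cons j k', ?_, fun c => ?_⟩
      · rw [Function.iterate_succ_apply', h1, partialD_iteratedFDeriv_apply hF]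
      · rw [Fin.prod_univ_succ]
        simp [h2, pow_succ']
        ring
  have main : ∀ L : List (Fin s), ∃ n, n = (L.map ν).sum ∧ ∃ k : Fin n → Fin s,
      (L.foldr (fun j H => (partialD j)^[ν j] H) F =
        fun y => iteratedFDeriv ℝ n F y fun i => Pi.single (k i) 1) ∧
      ∀ c : Fin s → ℝ, ∏ i, c (k i) = (L.map fun j => c j ^ ν j).prod := by
    intro L
    induction L with
    | nil =>
      refine ⟨0, rfl, fun i => i.elim0, ?_, fun c => ?_⟩
      · funext y
        rw [iteratedFDeriv_zero_apply, List.foldr_nil]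
      · rw [Fin.prod_univ_zero, List.map_nil, List.prod_nil]
    | cons j L ih =>
      obtain ⟨n, hn, k, h1, h2⟩ := ih
      obtain ⟨k', h3, h4⟩ := iter j (ν j) n k
      refine ⟨ν j + n, by rw [hn, List.map_cons, List.sum_cons], k', ?_, fun c => ?_⟩
      · rw [List.foldr_cons, h1, h3]
      · rw [List.map_cons, List.prod_cons, ← h2 c, h4 c]
  obtain ⟨n, hn, k, h1, h2⟩ := main (List.finRange s)
  rw [← Fin.sum_univ_def] at hn
  subst hn
  exact ⟨k, fun y => by rw [multiD, h1], fun c => by rw [h2, Fin.prod_univ_def]⟩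

/-- The map `h ↦ (h_j / c_j)_j` on `ℓ¹`. Partial derivatives in the original variables are
derivatives of the rescaled function in directions of length `c_j`. -/
noncomputable def rescale (c : Fin s → ℝ) : PiLp 1 (fun _ : Fin s => ℝ) →L[ℝ] (Fin s → ℝ) :=
  ContinuousLinearMap.pi fun j => (c j)⁻¹ • PiLp.proj 1 (fun _ : Fin s => ℝ) j

theorem rescale_apply (c : Fin s → ℝ) (h : PiLp 1 (fun _ : Fin s => ℝ)) (j : Fin s) :
    rescale c h j = (c j)⁻¹ * h j := by
  simp [rescale]

theorem rescale_surjective {c : Fin s → ℝ} (hc : ∀ j, 0 < c j) :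
    Function.Surjective (rescale c) := by
  intro y
  refine ⟨WithLp.toLp 1 fun j => c j * y j, ?_⟩
  funext j
  rw [rescale_apply]
  exact inv_mul_cancel_left₀ (hc j).ne' _

theorem rescale_single {c : Fin s → ℝ} (hc : ∀ j, 0 < c j) (j : Fin s) :
    rescale c (PiLp.single 1 j (c j)) = Pi.single j 1 := by
  funext i
  rw [rescale_apply, PiLp.single_apply]
  rcases eq_or_ne i j with rfl | h
  · simp [(hc i).ne']
  · simp [h]

theorem norm_comp_multiD_le {W : Type*} [NormedAddCommGroup W] [NormedSpace ℝ W] (J : V →L[ℝ] W)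
    {F : (Fin s → ℝ) → V} (hF : ContDiff ℝ ∞ F) {c : Fin s → ℝ} (hc : ∀ j, 0 < c j)
    (x : PiLp 1 (fun _ : Fin s => ℝ)) (ν : Fin s → ℕ) :
    ‖J (multiD ν F (rescale c x))‖ ≤
      ‖iteratedFDeriv ℝ (∑ j, ν j) (J ∘ (F ∘ rescale c)) x‖ * ∏ j, c j ^ ν j := by
  obtain ⟨k, h1, h2⟩ := exists_multiD_eq_iteratedFDeriv hF ν
  have hn : (((∑ j, ν j : ℕ) : ℕ∞) : WithTop ℕ∞) ≤ ∞ := by exact_mod_cast le_top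
  have e : J (multiD ν F (rescale c x)) =
      iteratedFDeriv ℝ (∑ j, ν j) (J ∘ (F ∘ rescale c)) x
        fun i => PiLp.single 1 (k i) (c (k i)) := by
    rw [J.iteratedFDeriv_comp_left (hF.comp (rescale c).contDiff).contDiffAt hn,
      ContinuousLinearMap.compContinuousMultilinearMap_coe, Function.comp_apply,
      (rescale c).iteratedFDeriv_comp_right hF x hn,
      ContinuousMultilinearMap.compContinuousLinearMap_apply, h1]
    simp only [rescale_single hc]
  rw [e, ← h2]
  refine (ContinuousMultilinearMap.le_opNorm _ _).trans_eq ?_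
  congr 1
  refine Finset.prod_congr rfl fun i _ => ?_
  rw [PiLp.norm_single, Real.norm_of_nonneg (hc _).le]

theorem norm_sum_smul_proj_comp_rescale_le {b c : Fin s → ℝ} (hc : ∀ j, 0 < c j)
    (hb : ∀ j, |b j| ≤ c j) :
    ‖(∑ j, b j • ContinuousLinearMap.proj (R := ℝ) (φ := fun _ : Fin s => ℝ) j) ∘L
      rescale c‖ ≤ 1 := by
  refine ContinuousLinearMap.opNorm_le_bound _ zero_le_one fun h => ?_
  rw [one_mul, PiLp.norm_eq_of_L1]
  have : ((∑ j, b j • ContinuousLinearMap.proj (R := ℝ) (φ := fun _ : Fin s => ℝ) j) ∘L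
      rescale c) h = ∑ j, b j * ((c j)⁻¹ * h j) := by
    simp [rescale_apply]
  rw [this]
  refine (norm_sum_le _ _).trans (Finset.sum_le_sum fun j _ => ?_)
  rw [← mul_assoc, norm_mul]
  refine mul_le_of_le_one_left (norm_nonneg _) ?_
  rw [Real.norm_eq_abs, abs_mul, abs_inv, abs_of_pos (hc j), ← div_eq_mul_inv]
  exact (div_le_one (hc j)).2 (hb j)

theorem abs_le_colMax {ι : Type} [Finite ι] (B : Matrix ι (Fin s) ℝ) (i : ι) (j : Fin s) :
    |B i j| ≤ colMax B j :=
  le_ciSup (f := fun i => |B i j|) (Set.finite_range _).bddAbove i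

end PartialDerivatives

/-! ### The Poincaré inequality -/

section Poincare

variable {d : ℕ}

theorem abs_fderiv_single_le_norm_gradient (φ : Euc d → ℝ) (k : Fin d) (x : Euc d) :
    |fderiv ℝ φ x (EuclideanSpace.single k 1)| ≤ ‖gradient φ x‖ := by
  have h := (fderiv ℝ φ x).le_opNorm (EuclideanSpace.single k 1)
  rw [gradient, LinearIsometryEquiv.norm_map]
  simpa using h

theorem integral_sq_eq_neg_integral_fderiv {φ : Euc d → ℝ} (hφ : ContDiff ℝ ∞ φ)
    (hc : HasCompactSupport φ) (k : Fin d) :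
    Integrable (fun x => φ x ^ 2) ∧
    Integrable (fun x => 2 * φ x * fderiv ℝ φ x (EuclideanSpace.single k 1) * x k) ∧
    ∫ x, φ x ^ 2 = -∫ x, 2 * φ x * fderiv ℝ φ x (EuclideanSpace.single k 1) * x k := by
  have hφd : Differentiable ℝ φ := hφ.differentiable (by simp)
  have hφ' : Continuous (fderiv ℝ φ) := hφ.continuous_fderiv (by simp)
  set v : Euc d := EuclideanSpace.single k 1 with hv
  have hp : Continuous fun x : Euc d => x k := by fun_prop
  have hpd : ∀ x, HasFDerivAt (fun x : Euc d => x k) (EuclideanSpace.proj (𝕜 := ℝ) k) x :=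
    fun x => (EuclideanSpace.proj (𝕜 := ℝ) k).hasFDerivAt
  have hfp : ∀ x, fderiv ℝ (fun x : Euc d => x k) x v = 1 := fun x => by
    rw [(hpd x).fderiv, hv]
    simp
  have hf2 : ∀ x, fderiv ℝ (fun x => φ x ^ 2) x v = 2 * φ x * fderiv ℝ φ x v := fun x => by
    rw [((hφd x).hasFDerivAt.pow 2).fderiv]
    simp
  have i1 : Integrable fun x => φ x ^ 2 :=
    (hφ.continuous.pow 2).integrable_of_hasCompactSupport
      (hc.mono fun x hx h0 => hx (by simp [h0]))
  have i3 : Integrable fun x => 2 * φ x * fderiv ℝ φ x v * x k :=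
    (((continuous_const.mul hφ.continuous).mul (hφ'.clm_apply continuous_const)).mul
      hp).integrable_of_hasCompactSupport (hc.mono fun x hx h0 => hx (by simp [h0]))
  have i4 : Integrable fun x => φ x ^ 2 * x k :=
    ((hφ.continuous.pow 2).mul hp).integrable_of_hasCompactSupport
      (hc.mono fun x hx h0 => hx (by simp [h0]))
  refine ⟨i1, i3, ?_⟩
  have ibp := integral_mul_fderiv_eq_neg_fderiv_mul_of_integrable (μ := (volume : Measure (Euc d)))
    (f := fun x => φ x ^ 2) (g := fun x => x k) (v := v)
    (by simp only [hf2]; exact i3) (by simp only [hfp, mul_one]; exact i1) i4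
    (fun x _ => (hφd x).pow 2) (fun x _ => (hpd x).differentiableAt)
  simp only [hfp, hf2, mul_one] at ibp
  exact ibp

/-- Integration by parts of `∫ φ² ∂ₖ xₖ`, followed by Young's inequality. -/
theorem integral_sq_le_integral_norm_gradient_sq {φ : Euc d → ℝ} (hφ : ContDiff ℝ ∞ φ)
    (hc : HasCompactSupport φ) (k : Fin d) {R : ℝ} (hR : ∀ x ∈ tsupport φ, |x k| ≤ R) :
    ∫ x, φ x ^ 2 ≤ 4 * R ^ 2 * ∫ x, ‖gradient φ x‖ ^ 2 := by
  obtain ⟨i1, i3, ibp⟩ := integral_sq_eq_neg_integral_fderiv hφ hc k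
  have hgc : Continuous (gradient φ) :=
    (InnerProductSpace.toDual ℝ (Euc d)).symm.continuous.comp (hφ.continuous_fderiv (by simp))
  have hgs : HasCompactSupport fun x => ‖gradient φ x‖ ^ 2 := by
    refine (hc.fderiv (𝕜 := ℝ)).mono fun x hx h0 => hx ?_
    simp only [gradient, h0, map_zero, norm_zero]
    norm_num
  have i2 : Integrable fun x => ‖gradient φ x‖ ^ 2 :=
    (hgc.norm.pow 2).integrable_of_hasCompactSupport hgs
  have hle : -∫ x, 2 * φ x * fderiv ℝ φ x (EuclideanSpace.single k 1) * x k ≤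
      ∫ x, (1 / 2 * φ x ^ 2 + 2 * R ^ 2 * ‖gradient φ x‖ ^ 2) := by
    rw [← integral_neg]
    refine integral_mono i3.neg ((i1.const_mul _).add (i2.const_mul _)) fun x => ?_
    have h1 := abs_fderiv_single_le_norm_gradient φ k x
    change -(2 * φ x * fderiv ℝ φ x (EuclideanSpace.single k 1) * x k) ≤
      1 / 2 * φ x ^ 2 + 2 * R ^ 2 * ‖gradient φ x‖ ^ 2
    generalize fderiv ℝ φ x (EuclideanSpace.single k 1) = a at h1 ⊢
    generalize ‖gradient φ x‖ = b at h1 ⊢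
    by_cases hx : x ∈ tsupport φ
    · have h2 : |x k * a| ≤ R * b := by
        rw [abs_mul]
        exact mul_le_mul (hR x hx) h1 (abs_nonneg _) ((abs_nonneg _).trans (hR x hx))
      have h3 : (x k * a) ^ 2 ≤ (R * b) ^ 2 := sq_le_sq.2 (h2.trans (le_abs_self _))
      nlinarith [sq_nonneg (φ x + 2 * (x k * a))]
    · have h0 : φ x = 0 := image_eq_zero_of_notMem_tsupport hx
      rw [h0]
      have : 0 ≤ 2 * R ^ 2 * b ^ 2 := by positivity
      linarith
  rw [← ibp, integral_add (i1.const_mul _) (i2.const_mul _), integral_const_mul,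
    integral_const_mul] at hle
  linarith

theorem norm_sq_eq_setIntegral {D : Set (Euc d)} {E : Type*} [NormedAddCommGroup E]
    [InnerProductSpace ℝ E] (f : Lp E 2 ((volume : Measure (Euc d)).restrict D)) :
    ‖f‖ ^ 2 = ∫ x in D, ‖f x‖ ^ 2 := by
  rw [← real_inner_self_eq_norm_sq, L2.inner_def]
  simp only [real_inner_self_eq_norm_sq]

theorem norm_fst_le_of_mem_testPairs {D : Set (Euc d)} (k : Fin d) {R : ℝ} (hR0 : 0 ≤ R)
    (hR : ∀ x ∈ D, |x k| ≤ R) {p : WithLp 2 (L2 D × L2Vec D)} (hp : p ∈ testPairs D) :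
    ‖p.fst‖ ≤ 2 * R * ‖p.snd‖ := by
  obtain ⟨φ, hφ, hc, hs, h1, h2⟩ := hp
  have e1 : ‖p.fst‖ ^ 2 = ∫ x, φ x ^ 2 := by
    rw [norm_sq_eq_setIntegral,
      ← setIntegral_eq_integral_of_forall_compl_eq_zero (s := D) (f := fun x => φ x ^ 2)
        fun x hx => by rw [image_eq_zero_of_notMem_tsupport fun h => hx (hs h)]; simp]
    refine integral_congr_ae ?_
    filter_upwards [h1] with x hx
    rw [hx, Real.norm_eq_abs, sq_abs]
  have e2 : ‖p.snd‖ ^ 2 = ∫ x, ‖gradient φ x‖ ^ 2 := by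
    rw [norm_sq_eq_setIntegral,
      ← setIntegral_eq_integral_of_forall_compl_eq_zero (s := D)
        (f := fun x => ‖gradient φ x‖ ^ 2) fun x hx => by
        rw [gradient, image_eq_zero_of_notMem_tsupport (f := fderiv ℝ φ)
          fun h => hx (hs (tsupport_fderiv_subset ℝ h))]
        simp]
    refine integral_congr_ae ?_
    filter_upwards [h2] with x hx
    rw [hx]
  have h := integral_sq_le_integral_norm_gradient_sq hφ hc k fun x hx => hR x (hs hx)
  rw [← e1, ← e2] at h
  refine abs_le_of_sq_le_sq' ?_ (by positivity) |>.2
  linarith [mul_pow (2 * R) ‖p.snd‖ 2]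

theorem span_testPairs_subset (D : Set (Euc d)) :
    (Submodule.span ℝ (testPairs D) : Set (WithLp 2 (L2 D × L2Vec D))) ⊆ testPairs D := by
  intro p hp
  induction hp using Submodule.span_induction with
  | mem p hp => exact hp
  | zero =>
    refine ⟨fun _ => 0, contDiff_const, HasCompactSupport.zero, by simp [tsupport], ?_, ?_⟩
    · exact Lp.coeFn_zero _ _ _
    · have : gradient (fun _ : Euc d => (0 : ℝ)) = 0 := by funext x; simp [gradient]
      simp only [this]
      exact Lp.coeFn_zero _ _ _
  | add p q _ _ hp hq =>
    obtain ⟨φ, hφ, hc, hs, h1, h2⟩ := hp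
    obtain ⟨ψ, hψ, hc', hs', h1', h2'⟩ := hq
    refine ⟨φ + ψ, hφ.add hψ, hc.add hc', (tsupport_add φ ψ).trans (Set.union_subset hs hs'),
      ?_, ?_⟩
    · filter_upwards [Lp.coeFn_add p.fst q.fst, h1, h1'] with x hx hx1 hx2
      rw [WithLp.add_fst, hx, Pi.add_apply, hx1, hx2, Pi.add_apply]
    · filter_upwards [Lp.coeFn_add p.snd q.snd, h2, h2'] with x hx hx1 hx2
      rw [WithLp.add_snd, hx, Pi.add_apply, hx1, hx2, gradient, gradient, gradient,
        fderiv_add (hφ.differentiable (by simp) x) (hψ.differentiable (by simp) x), map_add]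
  | smul a p _ hp =>
    obtain ⟨φ, hφ, hc, hs, h1, h2⟩ := hp
    refine ⟨a • φ, hφ.const_smul a, hc.smul_left (f := fun _ => a),
      (tsupport_smul_subset_right (fun _ => a) φ).trans hs, ?_, ?_⟩
    · filter_upwards [Lp.coeFn_smul a p.fst, h1] with x hx hx1
      rw [WithLp.smul_fst, hx, Pi.smul_apply, hx1, Pi.smul_apply]
    · filter_upwards [Lp.coeFn_smul a p.snd, h2] with x hx hx1
      rw [WithLp.smul_snd, hx, Pi.smul_apply, hx1, gradient, gradient,
        fderiv_const_smul (hφ.differentiable (by simp) x), map_smul]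

/-- The Poincaré inequality. -/
theorem exists_isEmbConst (hd : 1 ≤ d) {D : Set (Euc d)} (hDb : Bornology.IsBounded D) :
    ∃ c, IsEmbConst D c := by
  obtain ⟨R, hR0, hR⟩ := hDb.exists_pos_norm_le
  refine ⟨2 * R, by positivity, fun v => ?_⟩
  have hcl : IsClosed {p : WithLp 2 (L2 D × L2Vec D) | ‖p.fst‖ ≤ 2 * R * ‖p.snd‖} :=
    isClosed_le (WithLp.fstL 2 ℝ _ _).continuous.norm
      (continuous_const.mul (WithLp.sndL 2 ℝ _ _).continuous.norm)
  have hsub : (Submodule.span ℝ (testPairs D) : Set (WithLp 2 (L2 D × L2Vec D))) ⊆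
      {p | ‖p.fst‖ ≤ 2 * R * ‖p.snd‖} := fun p hp =>
    norm_fst_le_of_mem_testPairs ⟨0, hd⟩ hR0.le
      (fun x hx => (PiLp.norm_apply_le x _).trans (hR x hx)) (span_testPairs_subset D hp)
  exact closure_minimal hsub hcl v.2

end Poincare

/-! ### Multilinear interpolation weights -/

section Weights

theorem sum_hat_eq_one (n : ℕ) {t : ℝ} (h0 : 0 ≤ t) (hn : t ≤ n) :
    ∑ j ∈ Finset.range (n + 1), max 0 (1 - |t - j|) = 1 := by
  induction n with
  | zero =>
    have : t = 0 := le_antisymm (by simpa using hn) h0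
    simp [this]
  | succ n ih =>
    push_cast at hn
    rw [Finset.sum_range_succ]
    rcases le_total t n with h | h
    · rw [ih h, abs_of_nonpos (by push_cast; linarith), max_eq_left (by push_cast; linarith),
        add_zero]
    · have hz : ∑ j ∈ Finset.range n, max 0 (1 - |t - j|) = 0 := by
        refine Finset.sum_eq_zero fun j hj => ?_
        have hj' : (j : ℝ) + 1 ≤ n := by exact_mod_cast Finset.mem_range.1 hj
        rw [abs_of_nonneg (by linarith), max_eq_left (by linarith)]
      rw [Finset.sum_range_succ, hz, abs_of_nonneg (by linarith), abs_of_nonpos (by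
        push_cast; linarith), max_eq_right (by linarith), max_eq_right (by push_cast; linarith)]
      push_cast
      ring

variable {d : ℕ} (G : RectGrid d)

theorem RectGrid.weight_nonneg (i : G.Index) (x : Euc d) : 0 ≤ G.weight i x :=
  Finset.prod_nonneg fun _ _ => le_max_left _ _

theorem RectGrid.weight_le_one (i : G.Index) (x : Euc d) : G.weight i x ≤ 1 := by
  refine Finset.prod_le_one (fun _ _ => le_max_left _ _) fun k _ => ?_
  refine max_le zero_le_one (sub_le_self _ ?_)
  have := G.spacing_pos k
  positivity

theorem RectGrid.continuous_weight (i : G.Index) : Continuous (G.weight i) := by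
  unfold RectGrid.weight
  fun_prop

theorem RectGrid.sum_weight_eq_one {x : Euc d} (hx : x ∈ G.box) : ∑ i, G.weight i x = 1 := by
  have h1 : ∀ k, ∑ j : Fin (G.n k + 1),
      max 0 (1 - |x k - (G.origin k + ((j : ℕ) : ℝ) * G.spacing k)| / G.spacing k) = 1 := by
    intro k
    have hs := G.spacing_pos k
    obtain ⟨ha, hb⟩ := hx k
    refine Eq.trans ?_ (sum_hat_eq_one (G.n k) (t := (x k - G.origin k) / G.spacing k)
      (div_nonneg (by linarith) hs.le) ((div_le_iff₀ hs).2 (by linarith)))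
    rw [Finset.sum_range]
    refine Finset.sum_congr rfl fun j _ => ?_
    have e : (x k - G.origin k) / G.spacing k - ((j : ℕ) : ℝ) =
        (x k - (G.origin k + ((j : ℕ) : ℝ) * G.spacing k)) / G.spacing k := by
      field_simp
      ring
    rw [e, abs_div, abs_of_pos hs]
  have h2 := Finset.prod_univ_sum (fun k => (Finset.univ : Finset (Fin (G.n k + 1))))
    fun k j => max 0 (1 - |x k - (G.origin k + ((j : ℕ) : ℝ) * G.spacing k)| / G.spacing k)
  rw [Finset.prod_congr rfl fun k _ => h1 k, Finset.prod_const_one, Fintype.piFinset_univ] at h2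
  exact h2.symm

end Weights

/-! ### Multiplication operators -/

section MulOp

variable {α : Type*} [MeasurableSpace α] {μ : Measure α} {E : Type*} [NormedAddCommGroup E]
  [InnerProductSpace ℝ E]

/-- Multiplication by an essentially bounded function as an operator on `L²`. -/
noncomputable def mulOp (f : α → ℝ) (hf : MemLp f ⊤ μ) : Lp E 2 μ →L[ℝ] Lp E 2 μ :=
  (ContinuousLinearMap.lsmul ℝ ℝ).holderL μ ⊤ 2 2 (hf.toLp f)

theorem coeFn_mulOp (f : α → ℝ) (hf : MemLp f ⊤ μ) (v : Lp E 2 μ) :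
    mulOp f hf v =ᵐ[μ] fun x => f x • v x := by
  filter_upwards [(ContinuousLinearMap.lsmul ℝ ℝ).coeFn_holder (r := 2) (hf.toLp f) v,
    hf.coeFn_toLp] with x hx hf
  rw [mulOp, ContinuousLinearMap.holderL_apply_apply, hx, hf]
  rfl

theorem inner_mulOp (f : α → ℝ) (hf : MemLp f ⊤ μ) (v w : Lp E 2 μ) :
    inner ℝ (mulOp f hf v) w = ∫ x, f x * inner ℝ (v x) (w x) ∂μ := by
  rw [L2.inner_def]
  refine integral_congr_ae ?_
  filter_upwards [coeFn_mulOp f hf v] with x hx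
  rw [hx, real_inner_smul_left]

theorem inner_mulOp_mulOp (f g : α → ℝ) (hf : MemLp f ⊤ μ) (hg : MemLp g ⊤ μ)
    (v w : Lp E 2 μ) :
    inner ℝ (mulOp f hf (mulOp g hg v)) (mulOp g hg w) =
      ∫ x, f x * g x ^ 2 * inner ℝ (v x) (w x) ∂μ := by
  rw [inner_mulOp]
  refine integral_congr_ae ?_
  filter_upwards [coeFn_mulOp g hg v, coeFn_mulOp g hg w] with x hv hw
  rw [hv, hw, real_inner_smul_left, real_inner_smul_right]
  ring

theorem integrable_mul_inner (f : α → ℝ) (hf : MemLp f ⊤ μ) (v w : Lp E 2 μ) :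
    Integrable (fun x => f x * inner ℝ (v x) (w x)) μ := by
  refine (L2.integrable_inner (𝕜 := ℝ) (mulOp f hf v) w).congr ?_
  filter_upwards [coeFn_mulOp f hf v] with x hx
  rw [hx, real_inner_smul_left]

variable {ι : Type*} [Fintype ι] {f : ι → α → ℝ}

theorem coeFn_sum_smul_mulOp (hf : ∀ i, MemLp (f i) ⊤ μ) (t : ι → ℝ) (v : Lp E 2 μ) :
    (∑ i, t i • mulOp (f i) (hf i)) v =ᵐ[μ] fun x => (∑ i, t i * f i x) • v x := by
  rw [sum_apply]
  have h1 : ∀ᵐ x ∂μ, ∀ i, (t i • mulOp (f i) (hf i) v) x = (t i * f i x) • v x := by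
    refine ae_all_iff.2 fun i => ?_
    filter_upwards [Lp.coeFn_smul (t i) (mulOp (f i) (hf i) v), coeFn_mulOp (f i) (hf i) v]
      with x h1 h2
    rw [h1, Pi.smul_apply, h2, smul_smul]
  filter_upwards [h1, Lp.coeFn_fun_finsetSum Finset.univ
    fun i => t i • mulOp (f i) (hf i) v] with x h1 h2
  rw [Finset.sum_smul, ← Finset.sum_congr rfl fun i _ => h1 i]
  exact h2

theorem norm_sum_smul_mulOp_le (hf : ∀ i, MemLp (f i) ⊤ μ) (h0 : ∀ i x, 0 ≤ f i x)
    (h1 : ∀ᵐ x ∂μ, ∑ i, f i x = 1) (t : ι → ℝ) (c : ℝ) (hc : 0 ≤ c) (ht : ∀ i, |t i| ≤ c) :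
    ‖∑ i, t i • (mulOp (f i) (hf i) : Lp E 2 μ →L[ℝ] Lp E 2 μ)‖ ≤ c := by
  refine ContinuousLinearMap.opNorm_le_bound _ hc fun v => Lp.norm_le_mul_norm_of_ae_le_mul ?_
  filter_upwards [coeFn_sum_smul_mulOp hf t v, h1] with x hx hx1
  rw [hx, norm_smul]
  gcongr
  calc ‖∑ i, t i * f i x‖ ≤ ∑ i, c * f i x := by
        refine (norm_sum_le _ _).trans (Finset.sum_le_sum fun i _ => ?_)
        rw [norm_mul, Real.norm_of_nonneg (h0 i x), Real.norm_eq_abs]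
        exact mul_le_mul_of_nonneg_right (ht i) (h0 i x)
    _ = c := by rw [← Finset.mul_sum, hx1, mul_one]

theorem sum_mulOp_eq_one (hf : ∀ i, MemLp (f i) ⊤ μ) (h1 : ∀ᵐ x ∂μ, ∑ i, f i x = 1) :
    ∑ i, (mulOp (f i) (hf i) : Lp E 2 μ →L[ℝ] Lp E 2 μ) = 1 := by
  ext1 v
  refine Lp.ext ?_
  have h := coeFn_sum_smul_mulOp hf (fun _ => 1) v
  simp only [one_smul, one_mul] at h
  filter_upwards [h, h1] with x hx hx1
  rw [hx, hx1, one_smul]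
  rfl

end MulOp

/-! ### The norm of `H⁻¹(D)` -/

section Dual

variable {d : ℕ} {D : Set (Euc d)}

instance : CompleteSpace (H10 D) :=
  (Submodule.isClosed_topologicalClosure _).completeSpace_coe

/-- `v ↦ v` from `H¹₀(D)` to `L²(D)`. -/
noncomputable def fnL (D : Set (Euc d)) : H10 D →L[ℝ] L2 D :=
  WithLp.fstL 2 ℝ _ _ ∘L (h10Submodule D).subtypeL

/-- `v ↦ ∇v` from `H¹₀(D)` to `L²(D; ℝ^d)`. -/
noncomputable def gradL (D : Set (Euc d)) : H10 D →L[ℝ] L2Vec D :=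
  WithLp.sndL 2 ℝ _ _ ∘L (h10Submodule D).subtypeL

theorem fnL_apply (v : H10 D) : fnL D v = v.fn := rfl

theorem h10Norm_eq (v : H10 D) : h10Norm v = ‖gradL D v‖ := rfl

theorem integral_mul_fn_eq_inner (f : L2 D) (v : H10 D) :
    ∫ x in D, f x * v.fn x = inner ℝ f (fnL D v) := by
  rw [L2.inner_def, fnL_apply]
  refine integral_congr_ae (Filter.Eventually.of_forall fun x => ?_)
  exact mul_comm _ _

theorem hMinusOneNorm_eq (f : L2 D) :
    hMinusOneNorm f = ⨆ v : {v : H10 D // h10Norm v ≤ 1}, |inner ℝ f (fnL D v.1)| := by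
  simp only [hMinusOneNorm, integral_mul_fn_eq_inner]

theorem abs_inner_fnL_le_norm {c : ℝ} (hc : IsEmbConst D c) (f : L2 D)
    (v : {v : H10 D // h10Norm v ≤ 1}) : |inner ℝ f (fnL D v.1)| ≤ c * ‖f‖ := by
  calc |inner ℝ f (fnL D v.1)| ≤ ‖f‖ * ‖fnL D v.1‖ := abs_real_inner_le_norm _ _
    _ ≤ ‖f‖ * (c * h10Norm v.1) := by gcongr; exact hc.2 v.1
    _ ≤ ‖f‖ * (c * 1) := by have := hc.1; gcongr; exact v.2
    _ = c * ‖f‖ := by ring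

instance : Nonempty {v : H10 D // h10Norm v ≤ 1} :=
  ⟨⟨0, by rw [h10Norm_eq, map_zero, norm_zero]; exact zero_le_one⟩⟩

theorem IsEmbConst.isEmbConstDual {c : ℝ} (hc : IsEmbConst D c) : IsEmbConstDual D c := by
  refine ⟨hc.1, fun f => ?_⟩
  rw [hMinusOneNorm_eq]
  exact ciSup_le (abs_inner_fnL_le_norm hc f)

theorem hMinusOneNorm_nonneg (f : L2 D) : 0 ≤ hMinusOneNorm f :=
  Real.iSup_nonneg fun _ => abs_nonneg _

theorem abs_inner_fnL_le {c : ℝ} (hc : IsEmbConst D c) (f : L2 D) (v : H10 D) :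
    |inner ℝ f (fnL D v)| ≤ hMinusOneNorm f * h10Norm v := by
  have hle : ∀ w : H10 D, h10Norm w ≤ 1 → |inner ℝ f (fnL D w)| ≤ hMinusOneNorm f := by
    intro w hw
    rw [hMinusOneNorm_eq]
    refine le_ciSup (f := fun v : {v : H10 D // h10Norm v ≤ 1} => |inner ℝ f (fnL D v.1)|)
      ⟨c * ‖f‖, ?_⟩ ⟨w, hw⟩
    rintro _ ⟨v, rfl⟩
    exact abs_inner_fnL_le_norm hc f v
  have hv0 : 0 ≤ h10Norm v := norm_nonneg _
  rcases hv0.eq_or_lt with h | h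
  · have h1 : fnL D v = 0 := by
      rw [← norm_le_zero_iff]
      have := hc.2 v
      rwa [← h, mul_zero] at this
    rw [h1, ← h]
    simp
  · have h1 := hle ((h10Norm v)⁻¹ • v) (by
      rw [h10Norm_eq, map_smul, norm_smul, ← h10Norm_eq, norm_inv, Real.norm_of_nonneg hv0,
        inv_mul_cancel₀ h.ne'])
    rw [map_smul, real_inner_smul_right, abs_mul, abs_inv, abs_of_nonneg hv0] at h1
    rw [mul_comm]
    exact (inv_mul_le_iff₀ h).1 h1

theorem hMinusOneNorm_sub_le {c : ℝ} (hc : IsEmbConst D c) (f g : L2 D) :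
    hMinusOneNorm (f - g) ≤ hMinusOneNorm f + hMinusOneNorm g := by
  rw [hMinusOneNorm_eq (f - g)]
  refine ciSup_le fun v => ?_
  rw [inner_sub_left]
  refine (abs_sub _ _).trans (add_le_add ?_ ?_)
  · exact (abs_inner_fnL_le hc f v.1).trans
      (mul_le_of_le_one_right (hMinusOneNorm_nonneg f) v.2)
  · exact (abs_inner_fnL_le hc g v.1).trans
      (mul_le_of_le_one_right (hMinusOneNorm_nonneg g) v.2)

theorem norm_sq_le_mul_norm_gradL_sq {c : ℝ} (hc : IsEmbConst D c) (v : H10 D) :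
    ‖v‖ ^ 2 ≤ (c ^ 2 + 1) * ‖gradL D v‖ ^ 2 := by
  have h : ‖v‖ ^ 2 = ‖fnL D v‖ ^ 2 + ‖gradL D v‖ ^ 2 := WithLp.prod_norm_sq_eq_of_L2 v.1
  have h1 : ‖fnL D v‖ ≤ c * ‖gradL D v‖ := hc.2 v
  have h2 : ‖fnL D v‖ ^ 2 ≤ (c * ‖gradL D v‖) ^ 2 := by gcongr
  rw [h]
  linarith [mul_pow c ‖gradL D v‖ 2]

end Dual

/-! ### The interpolated lognormal coefficient -/

section Coefficient

open ContinuousLinearMap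

variable {d : ℕ} {D : Set (Euc d)} {G : RectGrid d} {s : ℕ} (B : Matrix G.Index (Fin s) ℝ)
  (Zbar : G.Index → ℝ) (y : Fin s → ℝ)

theorem memLp_top_of_mem_Icc {f : Euc d → ℝ} {μ : Measure (Euc d)} (hf : Measurable f) {c : ℝ}
    (h0 : ∀ x, 0 ≤ f x) (hc : ∀ x, f x ≤ c) : MemLp f ⊤ μ :=
  memLp_top_of_bound hf.aestronglyMeasurable c (Filter.Eventually.of_forall fun x => by
    rw [Real.norm_of_nonneg (h0 x)]; exact hc x)

theorem memLp_weight (D : Set (Euc d)) (i : G.Index) :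
    MemLp (G.weight i) ⊤ ((volume : Measure (Euc d)).restrict D) :=
  memLp_top_of_mem_Icc (G.continuous_weight i).measurable (G.weight_nonneg i)
    (G.weight_le_one i)

theorem fieldCE_eq_sum (x : Euc d) :
    fieldCE B Zbar y x = ∑ i, G.weight i x * Real.exp (gaussNode B Zbar y i) := rfl

theorem fieldCE_nonneg (x : Euc d) : 0 ≤ fieldCE B Zbar y x :=
  Finset.sum_nonneg fun i _ => mul_nonneg (G.weight_nonneg i x) (Real.exp_pos _).le

theorem continuous_fieldCE : Continuous (fieldCE B Zbar y) :=
  continuous_finsetSum _ fun i _ => (G.continuous_weight i).mul continuous_const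

theorem le_fieldCE {x : Euc d} (hx : x ∈ G.box) {α : ℝ}
    (hα : ∀ i, α ≤ Real.exp (gaussNode B Zbar y i)) : α ≤ fieldCE B Zbar y x := by
  calc α = ∑ i, G.weight i x * α := by rw [← Finset.sum_mul, G.sum_weight_eq_one hx, one_mul]
    _ ≤ fieldCE B Zbar y x :=
      Finset.sum_le_sum fun i _ => mul_le_mul_of_nonneg_left (hα i) (G.weight_nonneg i x)

theorem memLp_sqrt_fieldCE (D : Set (Euc d)) :
    MemLp (fun x => √(fieldCE B Zbar y x)) ⊤ ((volume : Measure (Euc d)).restrict D) := by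
  refine memLp_top_of_mem_Icc (c := √(∑ i, Real.exp (gaussNode B Zbar y i)))
    (continuous_fieldCE B Zbar y).sqrt.measurable (fun x => Real.sqrt_nonneg _) fun x => ?_
  refine Real.sqrt_le_sqrt (Finset.sum_le_sum fun i _ => ?_)
  exact mul_le_of_le_one_left (Real.exp_pos _).le (G.weight_le_one i x)

/-- The share of the grid point `x_i` in the coefficient at `x`. -/
noncomputable def relWeight (i : G.Index) (x : Euc d) : ℝ :=
  G.weight i x * Real.exp (gaussNode B Zbar y i) / fieldCE B Zbar y x

theorem relWeight_nonneg (i : G.Index) (x : Euc d) : 0 ≤ relWeight B Zbar y i x :=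
  div_nonneg (mul_nonneg (G.weight_nonneg i x) (Real.exp_pos _).le) (fieldCE_nonneg B Zbar y x)

theorem memLp_relWeight (D : Set (Euc d)) (i : G.Index) :
    MemLp (relWeight B Zbar y i) ⊤ ((volume : Measure (Euc d)).restrict D) := by
  refine memLp_top_of_mem_Icc (c := 1) ?_ (relWeight_nonneg B Zbar y i) fun x => ?_
  · exact ((G.continuous_weight i).measurable.mul_const _).div
      (continuous_fieldCE B Zbar y).measurable
  · refine div_le_one_of_le₀ ?_ (fieldCE_nonneg B Zbar y x)
    rw [fieldCE_eq_sum]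
    exact Finset.single_le_sum
      (f := fun i => G.weight i x * Real.exp (gaussNode B Zbar y i))
      (fun j _ => mul_nonneg (G.weight_nonneg j x) (Real.exp_pos _).le) (Finset.mem_univ i)

theorem fieldCE_pos {x : Euc d} (hx : x ∈ G.box) : 0 < fieldCE B Zbar y x := by
  obtain ⟨i, hi⟩ := Finite.exists_min fun i => Real.exp (gaussNode B Zbar y i)
  exact (Real.exp_pos _).trans_le (le_fieldCE B Zbar y hx hi)

theorem sum_relWeight_eq_one {x : Euc d} (hx : x ∈ G.box) : ∑ i, relWeight B Zbar y i x = 1 := by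
  simp only [relWeight]
  rw [← Finset.sum_div, ← fieldCE_eq_sum, div_self (fieldCE_pos B Zbar y hx).ne']

theorem ae_restrict_of_forall_box (hD : IsOpen D) (hDG : D ⊆ G.box) {p : Euc d → Prop}
    (h : ∀ x ∈ G.box, p x) : ∀ᵐ x ∂(volume : Measure (Euc d)).restrict D, p x :=
  (ae_restrict_iff' hD.measurableSet).2 (Filter.Eventually.of_forall fun x hx => h x (hDG hx))

theorem aMin_pos_and_le (hDb : Bornology.IsBounded D) {Z : Euc d → ℝ}
    (hZ : ContinuousOn Z (closure D)) (hZn : ∀ i, Z (G.node i) = gaussNode B Zbar y i) :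
    0 < aMin D G Z ∧ ∀ i, aMin D G Z ≤ Real.exp (gaussNode B Zbar y i) := by
  have hK : IsCompact ((fun x => Real.exp (Z x)) '' (closure D ∪ Set.range G.node)) := by
    rw [Set.image_union]
    exact (hDb.isCompact_closure.image_of_continuousOn hZ.rexp).union
      ((Set.finite_range _).image _).isCompact
  have hmem : ∀ i, Real.exp (gaussNode B Zbar y i) ∈
      (fun x => Real.exp (Z x)) '' (closure D ∪ Set.range G.node) := fun i =>
    ⟨G.node i, Or.inr ⟨i, rfl⟩, by simp only [hZn]⟩
  refine ⟨?_, fun i => csInf_le hK.bddBelow (hmem i)⟩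
  obtain ⟨x, -, hx⟩ := hK.sInf_mem ⟨_, hmem (Classical.arbitrary _)⟩
  rw [aMin, ← hx]
  exact Real.exp_pos _

/-! ### The operator of the diffusion equation -/

/-- The operator on `H¹₀(D)` that represents the form `(v, w) ↦ ∫_D a_s^y ∇v · ∇w` with respect
to the inner product of `H¹(D)`. -/
noncomputable def diffusionOp (D : Set (Euc d)) : H10 D →L[ℝ] H10 D :=
  ∑ i, Real.exp (gaussNode B Zbar y i) •
    (adjoint (gradL D) ∘L mulOp (G.weight i) (memLp_weight D i) ∘L gradL D)

theorem inner_diffusionOp (v w : H10 D) :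
    inner ℝ (diffusionOp B Zbar y D v) w =
      ∫ x in D, fieldCE B Zbar y x * inner ℝ (v.grad x) (w.grad x) := by
  have e : ∀ x, fieldCE B Zbar y x * inner ℝ (v.grad x) (w.grad x) =
      ∑ i, Real.exp (gaussNode B Zbar y i) *
        (G.weight i x * inner ℝ (v.grad x) (w.grad x)) := fun x => by
    rw [fieldCE_eq_sum, Finset.sum_mul]
    exact Finset.sum_congr rfl fun i _ => by ring
  simp only [e]
  rw [integral_finsetSum _ fun i _ =>
    (integrable_mul_inner _ (memLp_weight D i) v.grad w.grad).const_mul _]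
  rw [diffusionOp, sum_apply, sum_inner]
  refine Finset.sum_congr rfl fun i _ => ?_
  rw [integral_const_mul, ← inner_mulOp _ (memLp_weight D i), smul_apply, real_inner_smul_left,
    comp_apply, comp_apply, adjoint_inner_left]
  rfl

theorem isWeakSolution_iff (f : L2 D) (w : H10 D) :
    IsWeakSolution (fieldCE B Zbar y) f w ↔
      diffusionOp B Zbar y D w = adjoint (fnL D) f := by
  constructor
  · intro h
    refine ext_inner_right ℝ fun v => ?_
    rw [inner_diffusionOp, h v, integral_mul_fn_eq_inner, adjoint_inner_left]
  · intro h v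
    rw [← inner_diffusionOp, h, integral_mul_fn_eq_inner, adjoint_inner_left]

/-- `v ↦ (a_s^y)^{1/2} ∇v`. The norm of the image is the energy norm at the parameter `y`. -/
noncomputable def energyMap (D : Set (Euc d)) : H10 D →L[ℝ] L2Vec D :=
  mulOp _ (memLp_sqrt_fieldCE B Zbar y D) ∘L gradL D

theorem inner_energyMap_ae (v w : H10 D) :
    (fun x => inner ℝ (energyMap B Zbar y D v x) (energyMap B Zbar y D w x))
      =ᵐ[volume.restrict D] fun x => fieldCE B Zbar y x * inner ℝ (v.grad x) (w.grad x) := by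
  filter_upwards [coeFn_mulOp _ (memLp_sqrt_fieldCE B Zbar y D) v.grad,
    coeFn_mulOp _ (memLp_sqrt_fieldCE B Zbar y D) w.grad] with x hv hw
  change inner ℝ ((mulOp _ (memLp_sqrt_fieldCE B Zbar y D) v.grad) x)
    ((mulOp _ (memLp_sqrt_fieldCE B Zbar y D) w.grad) x) = _
  rw [hv, hw, real_inner_smul_left, real_inner_smul_right, ← mul_assoc,
    Real.mul_self_sqrt (fieldCE_nonneg B Zbar y x)]

theorem inner_energyMap (v w : H10 D) :
    inner ℝ (energyMap B Zbar y D v) (energyMap B Zbar y D w) =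
      inner ℝ (diffusionOp B Zbar y D v) w := by
  rw [inner_diffusionOp, L2.inner_def]
  exact integral_congr_ae (inner_energyMap_ae B Zbar y v w)

/-- Coercivity: a lower bound of the coefficient at the grid points is one on `D`. -/
theorem mul_norm_gradL_sq_le (hD : IsOpen D) (hDG : D ⊆ G.box) {α : ℝ}
    (hα : ∀ i, α ≤ Real.exp (gaussNode B Zbar y i)) (v : H10 D) :
    α * ‖gradL D v‖ ^ 2 ≤ ‖energyMap B Zbar y D v‖ ^ 2 := by
  rw [← real_inner_self_eq_norm_sq (energyMap B Zbar y D v), ← real_inner_self_eq_norm_sq,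
    inner_energyMap, inner_diffusionOp, ← real_inner_smul_left, L2.inner_def]
  have i1 : Integrable (fun x => fieldCE B Zbar y x * inner ℝ (v.grad x) (v.grad x))
      (volume.restrict D) := by
    exact (L2.integrable_inner (𝕜 := ℝ) (energyMap B Zbar y D v)
      (energyMap B Zbar y D v)).congr (inner_energyMap_ae B Zbar y v v)
  refine integral_mono_ae (L2.integrable_inner _ _) i1 ?_
  filter_upwards [Lp.coeFn_smul α (gradL D v),
    ae_restrict_of_forall_box hD hDG fun x hx => le_fieldCE B Zbar y hx hα] with x hx hx1
  rw [hx, Pi.smul_apply, real_inner_smul_left]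
  exact mul_le_mul_of_nonneg_right hx1 real_inner_self_nonneg

theorem isUnit_diffusionOp (hd : 1 ≤ d) (hD : IsOpen D) (hDb : Bornology.IsBounded D)
    (hDG : D ⊆ G.box) : IsUnit (diffusionOp B Zbar y D) := by
  obtain ⟨i, hi⟩ := Finite.exists_min fun i => Real.exp (gaussNode B Zbar y i)
  obtain ⟨c, hc⟩ := exists_isEmbConst hd hDb
  have hpos := Real.exp_pos (gaussNode B Zbar y i)
  have hc1 : 0 < c ^ 2 + 1 := by positivity
  refine isUnit_of_coercive (c := Real.exp (gaussNode B Zbar y i) / (c ^ 2 + 1))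
    (by positivity) fun v => ?_
  rw [← inner_energyMap, real_inner_self_eq_norm_sq]
  refine le_trans ?_ (mul_norm_gradL_sq_le B Zbar y hD hDG hi v)
  rw [mul_assoc, ← sq, div_mul_eq_mul_div, div_le_iff₀ hc1, mul_assoc]
  gcongr
  rw [mul_comm]
  exact norm_sq_le_mul_norm_gradL_sq hc v

theorem contDiff_sum_smul_const {ι E V : Type*} [Fintype ι] [NormedAddCommGroup E]
    [NormedSpace ℝ E] [NormedAddCommGroup V] [NormedSpace ℝ V] {f : ι → E → ℝ}
    (hf : ∀ i, ContDiff ℝ ∞ (f i)) (A : ι → V →L[ℝ] V) :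
    ContDiff ℝ ∞ fun y => ∑ i, f i y • A i :=
  ContDiff.sum fun i _ => (hf i).smul contDiff_const

theorem contDiff_diffusionOp (D : Set (Euc d)) :
    ContDiff ℝ ∞ fun y => diffusionOp B Zbar y D := by
  have h : ∀ i, ContDiff ℝ ∞ fun y => Real.exp (gaussNode B Zbar y i) := fun i => by
    unfold gaussNode
    fun_prop
  exact contDiff_sum_smul_const h fun i =>
    adjoint (gradL D) ∘L mulOp (G.weight i) (memLp_weight D i) ∘L gradL D

/-- The linear part of `y ↦ (By + Z̄)_i`. -/
noncomputable def rowFunctional (i : G.Index) : (Fin s → ℝ) →L[ℝ] ℝ :=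
  ∑ j, B i j • ContinuousLinearMap.proj (R := ℝ) (φ := fun _ : Fin s => ℝ) j

theorem gaussNode_eq_add_rowFunctional (y' : Fin s → ℝ) (i : G.Index) :
    gaussNode B Zbar y' i = gaussNode B Zbar y i + rowFunctional B i (y' - y) := by
  have h : ∀ z, rowFunctional B i z = ∑ j, B i j * z j := fun z => by simp [rowFunctional]
  rw [map_sub, h, h]
  simp only [gaussNode]
  ring

/-- At `y' = y`, where the sum in the middle is the identity, this factors `diffusionOp` as `J†J`;
in general the coefficient at `y'` enters relative to that at `y`. -/
theorem diffusionOp_eq_energyMap (hD : IsOpen D) (hDG : D ⊆ G.box) (y' : Fin s → ℝ) :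
    diffusionOp B Zbar y' D = adjoint (energyMap B Zbar y D) ∘L
      (∑ i, Real.exp (rowFunctional B i (y' - y)) •
        mulOp (relWeight B Zbar y i) (memLp_relWeight B Zbar y D i)) ∘L
      energyMap B Zbar y D := by
  ext1 v
  refine ext_inner_right ℝ fun w => ?_
  rw [comp_apply, comp_apply, adjoint_inner_left, sum_apply, sum_inner, diffusionOp, sum_apply,
    sum_inner]
  refine Finset.sum_congr rfl fun i _ => ?_
  rw [smul_apply, smul_apply, real_inner_smul_left, real_inner_smul_left, comp_apply, comp_apply,
    adjoint_inner_left, gaussNode_eq_add_rowFunctional B Zbar y y', Real.exp_add,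
    mul_comm (Real.exp (gaussNode B Zbar y i)), mul_assoc]
  congr 1
  rw [energyMap, comp_apply, comp_apply, inner_mulOp_mulOp, inner_mulOp, ← integral_const_mul]
  refine integral_congr_ae ?_
  filter_upwards [ae_restrict_of_forall_box hD hDG fun x hx => fieldCE_pos B Zbar y hx] with x hx
  rw [Real.sq_sqrt hx.le, relWeight, div_mul_cancel₀ _ hx.ne']
  ring

end Coefficient

/-! ### Estimates of the solutions -/

section Estimates

open ContinuousLinearMap

variable {d : ℕ} {D : Set (Euc d)} {G : RectGrid d} {s : ℕ} {B : Matrix G.Index (Fin s) ℝ}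
  {Zbar : G.Index → ℝ} {y : Fin s → ℝ} {α : ℝ}

theorem sqrt_mul_norm_gradL_le (hD : IsOpen D) (hDG : D ⊆ G.box) (hα0 : 0 ≤ α)
    (hα : ∀ i, α ≤ Real.exp (gaussNode B Zbar y i)) (v : H10 D) :
    √α * ‖gradL D v‖ ≤ ‖energyMap B Zbar y D v‖ := by
  refine abs_le_of_sq_le_sq' ?_ (norm_nonneg _) |>.2
  rw [mul_pow, Real.sq_sqrt hα0]
  exact mul_norm_gradL_sq_le B Zbar y hD hDG hα v

/-- The energy norm of a solution is controlled by its right-hand side. -/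
theorem norm_energyMap_le (hD : IsOpen D) (hDG : D ⊆ G.box) (hα0 : 0 < α)
    (hα : ∀ i, α ≤ Real.exp (gaussNode B Zbar y i)) {c : ℝ} (hc : IsEmbConst D c) {f : L2 D}
    {w : H10 D} (hw : diffusionOp B Zbar y D w = adjoint (fnL D) f) :
    ‖energyMap B Zbar y D w‖ ≤ hMinusOneNorm f / √α := by
  set J := energyMap B Zbar y D
  have hs : 0 < √α := Real.sqrt_pos.2 hα0
  have h1 : ‖J w‖ ^ 2 ≤ hMinusOneNorm f * ‖gradL D w‖ := by
    rw [← real_inner_self_eq_norm_sq, inner_energyMap, hw, adjoint_inner_left]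
    exact (le_abs_self _).trans (abs_inner_fnL_le hc f w)
  have h2 : ‖gradL D w‖ ≤ ‖J w‖ / √α := by
    rw [le_div_iff₀ hs, mul_comm]
    exact sqrt_mul_norm_gradL_le hD hDG hα0.le hα w
  have h3 : ‖J w‖ * ‖J w‖ ≤ hMinusOneNorm f / √α * ‖J w‖ := by
    calc ‖J w‖ * ‖J w‖ = ‖J w‖ ^ 2 := (sq _).symm
      _ ≤ hMinusOneNorm f * (‖J w‖ / √α) :=
        h1.trans (mul_le_mul_of_nonneg_left h2 (hMinusOneNorm_nonneg f))
      _ = _ := by ring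
  rcases (norm_nonneg (J w)).eq_or_lt with h | h
  · rw [← h]
    exact div_nonneg (hMinusOneNorm_nonneg f) hs.le
  · exact le_of_mul_le_mul_right h3 h

/-- A bound by strict majorants of `b` passes to `b` itself. -/
theorem le_mul_prod_pow_of_forall_pos {b : Fin s → ℝ} {ν : Fin s → ℕ} {X A C : ℝ}
    (h : ∀ ε > 0, X ≤ A * (∏ j, (b j + ε) ^ ν j) * C) : X ≤ A * (∏ j, b j ^ ν j) * C := by
  have hc : Continuous fun ε : ℝ => A * (∏ j, (b j + ε) ^ ν j) * C := by fun_prop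
  have ht := (hc.tendsto 0).mono_left (nhdsWithin_le_nhds (s := Set.Ioi 0))
  simp only [add_zero] at ht
  exact ge_of_tendsto ht (eventually_mem_nhdsWithin.mono h)

/-- Bounds for the total derivatives of `F ∘ rescale c` in the energy norm give bounds for the
partial derivatives of `F`. The scales are strict majorants of `colMax B`, which may have zero
entries. -/
theorem h10Norm_multiD_le_of_energy (hD : IsOpen D) (hDG : D ⊆ G.box) (hα0 : 0 < α)
    (hα : ∀ i, α ≤ Real.exp (gaussNode B Zbar y i)) {F : (Fin s → ℝ) → H10 D}
    (hF : ContDiff ℝ ∞ F) (ν : Fin s → ℕ) {K : ℝ}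
    (hK : ∀ (c : Fin s → ℝ) (x₀ : PiLp 1 fun _ : Fin s => ℝ), (∀ j, 0 < c j) →
      (∀ j, colMax B j ≤ c j) → rescale c x₀ = y →
      ‖iteratedFDeriv ℝ (∑ j, ν j) (energyMap B Zbar y D ∘ (F ∘ rescale c)) x₀‖ ≤ K) :
    h10Norm (multiD ν F y) ≤ K / √α * ∏ j, colMax B j ^ ν j := by
  have hs : 0 < √α := Real.sqrt_pos.2 hα0
  have hb0 : ∀ j, 0 ≤ colMax B j := fun j => Real.iSup_nonneg fun _ => abs_nonneg _
  -- Some `colMax B j` may vanish, so the scales are `colMax B j + ε`, and `ε` tends to zero.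
  rw [← mul_one (K / √α * _)]
  refine le_mul_prod_pow_of_forall_pos fun ε hε => ?_
  have hc : ∀ j, 0 < colMax B j + ε := fun j => add_pos_of_nonneg_of_pos (hb0 j) hε
  obtain ⟨x₀, hx₀⟩ := rescale_surjective hc y
  have h1 := norm_comp_multiD_le (energyMap B Zbar y D) hF hc x₀ ν
  rw [hx₀] at h1
  have h2 := hK _ x₀ hc (fun j => le_add_of_nonneg_right hε.le) hx₀
  have h3 := sqrt_mul_norm_gradL_le hD hDG hα0.le hα (multiD ν F y)
  have hprod : 0 ≤ ∏ j, (colMax B j + ε) ^ ν j :=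
    Finset.prod_nonneg fun j _ => pow_nonneg (hc j).le _
  rw [mul_one, h10Norm_eq, div_mul_eq_mul_div, le_div_iff₀ hs, mul_comm]
  exact h3.trans (h1.trans (mul_le_mul_of_nonneg_right h2 hprod))

theorem exp_rowFunctional_comp_rescale {c : Fin s → ℝ} (x x₀ : PiLp 1 fun _ : Fin s => ℝ)
    (i : G.Index) :
    Real.exp ((rowFunctional B i ∘L rescale c) (x - x₀)) =
      Real.exp (rowFunctional B i (rescale c x - rescale c x₀)) := by
  rw [comp_apply, map_sub (rescale c)]

theorem h10Norm_multiD_state_le (hD : IsOpen D) (hDG : D ⊆ G.box)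
    (hT : ∀ y, IsUnit (diffusionOp B Zbar y D)) (hα0 : 0 < α)
    (hα : ∀ i, α ≤ Real.exp (gaussNode B Zbar y i)) {c₂ : ℝ} (hc₂ : IsEmbConst D c₂)
    {u : (Fin s → ℝ) → H10 D} (hu : ContDiff ℝ ∞ u) {z : L2 D}
    (huz : ∀ y, diffusionOp B Zbar y D (u y) = adjoint (fnL D) z) (ν : Fin s → ℕ) :
    h10Norm (multiD ν u y) ≤ ((∑ j, ν j).factorial : ℝ) *
      ((∏ j, colMax B j ^ ν j) / Real.log 2 ^ (∑ j, ν j)) * (hMinusOneNorm z / α) := by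
  have hl2 : 0 < Real.log 2 := Real.log_pos (by norm_num)
  refine (h10Norm_multiD_le_of_energy hD hDG hα0 hα hu ν
    (K := (∑ j, ν j).factorial / Real.log 2 ^ (∑ j, ν j) * (hMinusOneNorm z / √α))
    fun c x₀ hc hBc hx₀ => ?_).trans_eq ?_
  · have h1 := norm_iteratedFDeriv_solution_le_factorial (energyMap B Zbar y D) (x₀ := x₀)
      (l := fun i => rowFunctional B i ∘L rescale c)
      (T := fun x => diffusionOp B Zbar (rescale c x) D)
      (fun i => norm_sum_smul_proj_comp_rescale_le hc fun j => (abs_le_colMax B i j).trans (hBc j))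
      (norm_sum_smul_mulOp_le (memLp_relWeight B Zbar y D) (relWeight_nonneg B Zbar y)
        (ae_restrict_of_forall_box hD hDG fun x hx => sum_relWeight_eq_one B Zbar y hx))
      (sum_mulOp_eq_one (memLp_relWeight B Zbar y D)
        (ae_restrict_of_forall_box hD hDG fun x hx => sum_relWeight_eq_one B Zbar y hx))
      (fun x => hT _)
      (fun x => by
        simp only [exp_rowFunctional_comp_rescale, hx₀]
        exact diffusionOp_eq_energyMap B Zbar y hD hDG _)
      (hu.comp (rescale c).contDiff) (fun x => huz _) (∑ j, ν j)
    refine h1.trans ?_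
    gcongr
    rw [Function.comp_apply, hx₀]
    exact norm_energyMap_le hD hDG hα0 hα hc₂ (huz y)
  · have hsα : √α * √α = α := Real.mul_self_sqrt hα0.le
    rw [← mul_div_assoc, div_div, hsα]
    ring

/-- The solution operator applied to functions in `H¹₀(D)` has norm at most `c₁ c₂ / α` in the
energy norm. -/
theorem norm_energyMap_inverse_le (hD : IsOpen D) (hDG : D ⊆ G.box)
    (hT : IsUnit (diffusionOp B Zbar y D)) (hα0 : 0 < α)
    (hα : ∀ i, α ≤ Real.exp (gaussNode B Zbar y i)) {c₁ c₂ : ℝ} (hc₁ : IsEmbConstDual D c₁)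
    (hc₂ : IsEmbConst D c₂) (v : H10 D) :
    ‖energyMap B Zbar y D (Ring.inverse (diffusionOp B Zbar y D)
      ((adjoint (fnL D) ∘L fnL D) v))‖ ≤ c₁ * c₂ / α * ‖energyMap B Zbar y D v‖ := by
  have hs : 0 < √α := Real.sqrt_pos.2 hα0
  have h0 := norm_energyMap_le hD hDG hα0 hα hc₂ (f := fnL D v)
    ((apply_eq_iff_eq_ringInverse hT _ _).2 rfl)
  refine h0.trans ?_
  have h1 : hMinusOneNorm (fnL D v) ≤ c₁ * (c₂ * ‖gradL D v‖) :=
    (hc₁.2 _).trans (mul_le_mul_of_nonneg_left (hc₂.2 v) hc₁.1.le)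
  have h2 := sqrt_mul_norm_gradL_le hD hDG hα0.le hα v
  have h3 : 0 ≤ c₁ * c₂ := (mul_pos hc₁.1 hc₂.1).le
  rw [div_le_iff₀ hs]
  calc hMinusOneNorm (fnL D v) ≤ c₁ * c₂ * ‖gradL D v‖ := by rw [mul_assoc]; exact h1
    _ = c₁ * c₂ / α * (√α * ‖gradL D v‖) * √α := by
      have hsα : √α * √α = α := Real.mul_self_sqrt hα0.le
      rw [mul_assoc (c₁ * c₂ / α), mul_right_comm (√α), hsα]
      field_simp
    _ ≤ _ := by gcongr

theorem h10Norm_multiD_adjoint_le (hD : IsOpen D) (hDG : D ⊆ G.box)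
    (hT : ∀ y, IsUnit (diffusionOp B Zbar y D)) (hα0 : 0 < α)
    (hα : ∀ i, α ≤ Real.exp (gaussNode B Zbar y i)) {c₁ c₂ : ℝ} (hc₁ : IsEmbConstDual D c₁)
    (hc₂ : IsEmbConst D c₂) {u q : (Fin s → ℝ) → H10 D} (hu : ContDiff ℝ ∞ u)
    (hq : ContDiff ℝ ∞ q) {z g : L2 D}
    (huz : ∀ y, diffusionOp B Zbar y D (u y) = adjoint (fnL D) z)
    (hqg : ∀ y, diffusionOp B Zbar y D (q y) = adjoint (fnL D) ((u y).fn - g))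
    (ν : Fin s → ℕ) :
    h10Norm (multiD ν q y) ≤ (((∑ j, ν j) + 1).factorial : ℝ) *
      ((∏ j, colMax B j ^ ν j) / Real.log 2 ^ (∑ j, ν j)) * (constQ c₁ c₂ α / α) *
      (hMinusOneNorm z + hMinusOneNorm g) := by
  have hl2 : 0 < Real.log 2 := Real.log_pos (by norm_num)
  have hs : 0 < √α := Real.sqrt_pos.2 hα0
  have hz := hMinusOneNorm_nonneg z
  have hg := hMinusOneNorm_nonneg g
  have hκ : 0 ≤ c₁ * c₂ / α := (div_pos (mul_pos hc₁.1 hc₂.1) hα0).le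
  have hC1 : 1 ≤ constQ c₁ c₂ α := le_max_left _ _
  have hC2 : c₁ * c₂ / α ≤ constQ c₁ c₂ α := le_max_right _ _
  have hu0 := norm_energyMap_le hD hDG hα0 hα hc₂ (huz y)
  set K := constQ c₁ c₂ α * (hMinusOneNorm z + hMinusOneNorm g) / √α with hK
  have hK2 : c₁ * c₂ / α * ‖energyMap B Zbar y D (u y)‖ ≤ K := by
    calc c₁ * c₂ / α * ‖energyMap B Zbar y D (u y)‖
        ≤ constQ c₁ c₂ α * ((hMinusOneNorm z + hMinusOneNorm g) / √α) := by
          gcongr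
          refine hu0.trans ?_
          gcongr
          linarith
      _ = K := by rw [hK]; ring
  have hK1 : ‖energyMap B Zbar y D (q y)‖ ≤ K := by
    refine (norm_energyMap_le hD hDG hα0 hα hc₂ (hqg y)).trans ?_
    rw [hK]
    gcongr
    have h1 : hMinusOneNorm (u y).fn ≤ c₁ * c₂ / α * hMinusOneNorm z := by
      have h2 : ‖gradL D (u y)‖ ≤ hMinusOneNorm z / α := by
        have h3 := (sqrt_mul_norm_gradL_le hD hDG hα0.le hα (u y)).trans hu0
        rw [le_div_iff₀ hs] at h3
        rw [le_div_iff₀ hα0]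
        calc ‖gradL D (u y)‖ * α = √α * ‖gradL D (u y)‖ * √α := by
              rw [mul_right_comm, Real.mul_self_sqrt hα0.le, mul_comm]
          _ ≤ _ := h3
      calc hMinusOneNorm (u y).fn ≤ c₁ * ‖(u y).fn‖ := hc₁.2 _
        _ ≤ c₁ * (c₂ * (hMinusOneNorm z / α)) := by
          have := hc₁.1
          have := hc₂.1
          gcongr
          exact (hc₂.2 (u y)).trans (by rw [h10Norm_eq]; gcongr)
        _ = _ := by ring
    calc hMinusOneNorm ((u y).fn - g) ≤ hMinusOneNorm (u y).fn + hMinusOneNorm g :=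
          hMinusOneNorm_sub_le hc₂ _ _
      _ ≤ constQ c₁ c₂ α * hMinusOneNorm z + constQ c₁ c₂ α * hMinusOneNorm g := by
          refine add_le_add (h1.trans ?_) (le_mul_of_one_le_left hg hC1)
          gcongr
      _ = _ := by ring
  refine (h10Norm_multiD_le_of_energy hD hDG hα0 hα hq ν
    (K := ((∑ j, ν j) + 1).factorial / Real.log 2 ^ (∑ j, ν j) * K)
    fun c x₀ hc hBc hx₀ => ?_).trans_eq ?_
  · exact norm_iteratedFDeriv_coupled_solution_le_factorial (energyMap B Zbar y D) (x₀ := x₀)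
      (l := fun i => rowFunctional B i ∘L rescale c)
      (T := fun x => diffusionOp B Zbar (rescale c x) D)
      (fun i => norm_sum_smul_proj_comp_rescale_le hc fun j => (abs_le_colMax B i j).trans (hBc j))
      (norm_sum_smul_mulOp_le (memLp_relWeight B Zbar y D) (relWeight_nonneg B Zbar y)
        (ae_restrict_of_forall_box hD hDG fun x hx => sum_relWeight_eq_one B Zbar y hx))
      (sum_mulOp_eq_one (memLp_relWeight B Zbar y D)
        (ae_restrict_of_forall_box hD hDG fun x hx => sum_relWeight_eq_one B Zbar y hx))
      (fun x => hT _)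
      (fun x => by
        simp only [exp_rowFunctional_comp_rescale, hx₀]
        exact diffusionOp_eq_energyMap B Zbar y hD hDG _)
      (hu.comp (rescale c).contDiff) (hq.comp (rescale c).contDiff)
      (b := adjoint (fnL D) ∘L fnL D) (g := adjoint (fnL D) g) (fun x => huz _)
      (fun x => by
        rw [Function.comp_apply, hqg, map_sub]
        rfl)
      hκ
      (fun v => by
        rw [hx₀]
        exact norm_energyMap_inverse_le hD hDG (hT y) hα0 hα hc₁ hc₂ v)
      (by rw [Function.comp_apply, hx₀]; exact hK1)
      (by rw [Function.comp_apply, hx₀]; exact hK2) (∑ j, ν j)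
  · rw [hK]
    have hsα : √α * √α = α := Real.mul_self_sqrt hα0.le
    rw [mul_div_assoc', div_div, hsα]
    ring

end Estimates

theorem mainTheorem5 {d : ℕ} (hd : 1 ≤ d) (D : Set (Euc d)) (hD : IsOpen D)
    (hDb : Bornology.IsBounded D) (G : RectGrid d) (hDG : D ⊆ G.box)
    {s : ℕ} (B : Matrix G.Index (Fin s) ℝ) (Zbar : G.Index → ℝ) (z g : L2 D) :
    (∃ c₁, IsEmbConstDual D c₁) ∧ (∃ c₂, IsEmbConst D c₂) ∧
    ∃ u q : (Fin s → ℝ) → H10 D,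
      (∀ y w, IsWeakSolution (fieldCE B Zbar y) z w ↔ w = u y) ∧
      (∀ y w, IsWeakSolution (fieldCE B Zbar y) ((u y).fn - g) w ↔ w = q y) ∧
      ContDiff ℝ ∞ u ∧ ContDiff ℝ ∞ q ∧
      ∀ (y : Fin s → ℝ) (Z : Euc d → ℝ), ContinuousOn Z (closure D) →
        (∀ i, Z (G.node i) = gaussNode B Zbar y i) →
        ∀ ν : Fin s → ℕ,
          h10Norm (multiD ν u y) ≤
            ((∑ j, ν j).factorial : ℝ) *
              ((∏ j, colMax B j ^ ν j) / Real.log 2 ^ (∑ j, ν j)) *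
              (hMinusOneNorm z / aMin D G Z) ∧
          ∀ c₁ c₂ : ℝ, IsEmbConstDual D c₁ → IsEmbConst D c₂ →
            h10Norm (multiD ν q y) ≤
              (((∑ j, ν j) + 1).factorial : ℝ) *
                ((∏ j, colMax B j ^ ν j) / Real.log 2 ^ (∑ j, ν j)) *
                (constQ c₁ c₂ (aMin D G Z) / aMin D G Z) *
                (hMinusOneNorm z + hMinusOneNorm g) := by
  obtain ⟨c₂, hc₂⟩ := exists_isEmbConst hd hDb
  have hT : ∀ y, IsUnit (diffusionOp B Zbar y D) := fun y =>
    isUnit_diffusionOp B Zbar y hd hD hDb hDG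
  let u : (Fin s → ℝ) → H10 D := fun y =>
    Ring.inverse (diffusionOp B Zbar y D) (ContinuousLinearMap.adjoint (fnL D) z)
  let q : (Fin s → ℝ) → H10 D := fun y =>
    Ring.inverse (diffusionOp B Zbar y D) (ContinuousLinearMap.adjoint (fnL D) ((u y).fn - g))
  have hu : ContDiff ℝ ∞ u :=
    contDiff_ringInverse_apply (contDiff_diffusionOp B Zbar D) hT contDiff_const
  have hq : ContDiff ℝ ∞ q :=
    contDiff_ringInverse_apply (contDiff_diffusionOp B Zbar D) hT
      ((ContinuousLinearMap.adjoint (fnL D)).contDiff.comp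
        (((fnL D).contDiff.comp hu).sub contDiff_const))
  have huz : ∀ y, diffusionOp B Zbar y D (u y) = ContinuousLinearMap.adjoint (fnL D) z :=
    fun y => (apply_eq_iff_eq_ringInverse (hT y) _ _).2 rfl
  have hqg : ∀ y, diffusionOp B Zbar y D (q y) =
      ContinuousLinearMap.adjoint (fnL D) ((u y).fn - g) :=
    fun y => (apply_eq_iff_eq_ringInverse (hT y) _ _).2 rfl
  refine ⟨⟨c₂, hc₂.isEmbConstDual⟩, ⟨c₂, hc₂⟩, u, q, fun y w => ?_, fun y w => ?_, hu, hq,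
    fun y Z hZ hZn ν => ?_⟩
  · rw [isWeakSolution_iff, apply_eq_iff_eq_ringInverse (hT y)]
  · rw [isWeakSolution_iff, apply_eq_iff_eq_ringInverse (hT y)]
  · obtain ⟨hα0, hα⟩ := aMin_pos_and_le B Zbar y hDb hZ hZn
    exact ⟨h10Norm_multiD_state_le hD hDG hT hα0 hα hc₂ hu huz ν,
      fun c₁ c₂ hc₁ hc₂ => h10Norm_multiD_adjoint_le hD hDG hT hα0 hα hc₁ hc₂ hu hq huz hqg ν⟩
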